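/- Let $X$ be a paracompact (Hausdorff) complex manifold, $\mathcal O_X$ its sheaf of holomorphic functions, $\mathcal O_X^*$ the sheaf of nowhere vanishing holomorphic functions and $\Omega^1_X$ the sheaf of holomorphic $1$-forms. A holomorphic connection on a holomorphic line bundle $L$ (identified with its sheaf of holomorphic sections) is a $\mathbb C$-linear morphism of sheaves $\nabla: L\to\Omega^1_X\otimes_{\mathcal O_X} L$ with $\nabla(fs)=f\nabla(s)+df\otimes s$. Let $\mathrm{Pic}^{an}(X)$ be the set of isomorphism classes of holomorphic line bundles on $X$, and $\mathrm{Pic}^{an}_c(X)$ the set of isomorphism classes of pairs $(L,\nabla)$ of a holomorphic line bundle with a holomorphic connection; both are abelian groups under the tensor product, where $L\otimes L'$ carries the connection $s\otimes t\mapsto\nabla s\otimes t+s\otimes\nabla' t$. Let $H^1(X,\Omega^1_X)$ be the first cohomology group, computed as the direct limit of the \v{C}ech groups $H^1(\mathcal U,\Omega^1_X)$ over all open coverings $\mathcal U$ of $X$. Then there is an exact sequence of abelian groups $$H^0(X,\mathcal O_X^*)\to H^0(X,\Omega^1_X)\to \mathrm{Pic}^{an}_c(X)\to \mathrm{Pic}^{an}(X)\to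 H^1(X,\Omega^1_X),$$ whose maps are $g\mapsto dg/g$; $\omega\mapsto$ the class of $(\mathcal O_X,\ f\mapsto df+f\omega)$; the class of $(L,\nabla)\mapsto$ the class of $L$; and the class of $L\mapsto$ the class of the \v{C}ech cocycle $(dg_{ij}/g_{ij})$, where $(s_i)$ are nowhere vanishing holomorphic sections of $L$ over the members of an open covering $(U_i)$ and $s_j=g_{ij}s_i$ on $U_i\cap U_j$. In particular, $L$ admits a holomorphic connection if and only if its image in $H^1(X,\Omega^1_X)$ vanishes. -/

import Mathlib

open scoped Manifold ContDiff Topology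
open Bundle TopologicalSpace

noncomputable section

namespace HolLine

section Sections

variable {E : Type*} [NormedAddCommGroup E] [NormedSpace ℂ E]
  {X : Type*} [TopologicalSpace X] [ChartedSpace E X]

/-- The ring `𝒪(U)` of holomorphic functions on an open subset `U` of the complex manifold `X`.
The extension `t` is an arbitrary function; it is only required to be holomorphic on `U`. -/
def holFun (E : Type*) [NormedAddCommGroup E] [NormedSpace ℂ E]
    {X : Type*} [TopologicalSpace X] [ChartedSpace E X] (U : Opens X) :
    Subalgebra ℂ (U → ℂ) where
  carrier := {f | ∃ t : X → ℂ, ContMDiffOn 𝓘(ℂ, E) 𝓘(ℂ, ℂ) ω t U ∧ ∀ x : U, t x = f x}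
  mul_mem' := by
    rintro f g ⟨t, ht, htf⟩ ⟨u, hu, hug⟩
    exact ⟨fun x => t x * u x, ht.mul hu, fun x => by simp [htf, hug]⟩
  add_mem' := by
    rintro f g ⟨t, ht, htf⟩ ⟨u, hu, hug⟩
    exact ⟨fun x => t x + u x, ht.add hu, fun x => by simp [htf, hug]⟩
  algebraMap_mem' c := ⟨fun _ => c, contMDiffOn_const, fun _ => rfl⟩

/-- The `𝒪(U)`-module of holomorphic sections over `U` of a vector bundle `V` on `X`
with model fibre `F`. Again the extension `t` is arbitrary outside `U`. -/
def holSec (E : Type*) [NormedAddCommGroup E] [NormedSpace ℂ E]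
    {X : Type*} [TopologicalSpace X] [ChartedSpace E X]
    (F : Type*) [NormedAddCommGroup F] [NormedSpace ℂ F]
    (V : X → Type*) [TopologicalSpace (TotalSpace F V)] [∀ x, AddCommGroup (V x)]
    [∀ x, Module ℂ (V x)] [∀ x, TopologicalSpace (V x)] [FiberBundle F V] [VectorBundle ℂ F V]
    (U : Opens X) : Submodule (holFun E U) (∀ x : U, V x) where
  carrier := {s | ∃ t : ∀ x, V x,
    ContMDiffOn 𝓘(ℂ, E) (𝓘(ℂ, E).prod 𝓘(ℂ, F)) ω (fun x => TotalSpace.mk' F x (t x)) U ∧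
      ∀ x : U, t x = s x}
  add_mem' := by
    rintro f g ⟨t, ht, htf⟩ ⟨u, hu, hug⟩
    exact ⟨t + u, ht.add_section hu, fun x => by simp [htf, hug]⟩
  zero_mem' := ⟨0, contMDiffOn_zeroSection ℂ V, fun _ => rfl⟩
  smul_mem' := by
    rintro ⟨c, t, ht, htc⟩ s ⟨u, hu, hus⟩
    refine ⟨t • u, ht.smul_section hu, fun x => ?_⟩
    change t x • u x = c x • s x
    rw [htc, hus]

/-- The type of holomorphic sections of `V` over `U`. -/
def HolSec (E : Type*) [NormedAddCommGroup E] [NormedSpace ℂ E]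
    {X : Type*} [TopologicalSpace X] [ChartedSpace E X]
    (F : Type*) [NormedAddCommGroup F] [NormedSpace ℂ F]
    (V : X → Type*) [TopologicalSpace (TotalSpace F V)] [∀ x, AddCommGroup (V x)]
    [∀ x, Module ℂ (V x)] [∀ x, TopologicalSpace (V x)] [FiberBundle F V] [VectorBundle ℂ F V]
    (U : Opens X) : Type _ := ↥(holSec E F V U)

/-- Restriction of holomorphic functions. -/
def holFun.res {U W : Opens X} (h : W ≤ U) (f : holFun E U) : holFun E W :=
  ⟨fun x => f.1 ⟨x, h x.2⟩, by
    obtain ⟨t, ht, e⟩ := f.2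
    exact ⟨t, ht.mono h, fun x => e ⟨x, h x.2⟩⟩⟩

namespace HolSec

variable {F : Type*} [NormedAddCommGroup F] [NormedSpace ℂ F]
    {V : X → Type*} [TopologicalSpace (TotalSpace F V)] [∀ x, AddCommGroup (V x)]
    [∀ x, Module ℂ (V x)] [∀ x, TopologicalSpace (V x)] [FiberBundle F V] [VectorBundle ℂ F V] {U W : Opens X}

instance : AddCommGroup (HolSec E F V U) := inferInstanceAs (AddCommGroup (holSec E F V U))

instance : Module (holFun E U) (HolSec E F V U) :=
  inferInstanceAs (Module (holFun E U) (holSec E F V U))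

/-- Complex scalars act on sections as constant functions. -/
instance : Module ℂ (HolSec E F V U) := Module.compHom _ (algebraMap ℂ (holFun E U))

@[ext]
theorem ext {s t : HolSec E F V U} (h : ∀ x, s.1 x = t.1 x) : s = t := Subtype.ext (funext h)

theorem add_apply (s t : HolSec E F V U) (x : U) : (s + t).1 x = s.1 x + t.1 x := rfl

theorem smul_apply (f : holFun E U) (s : HolSec E F V U) (x : U) :
    (f • s).1 x = f.1 x • s.1 x := rfl

/-- Restriction of holomorphic sections. -/
def res (h : W ≤ U) : HolSec E F V U →+ HolSec E F V W where
  toFun s := ⟨fun x => s.1 ⟨x, h x.2⟩, by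
    obtain ⟨t, ht, e⟩ := s.2
    exact ⟨t, ht.mono h, fun x => e ⟨x, h x.2⟩⟩⟩
  map_zero' := rfl
  map_add' _ _ := rfl

end HolSec

end Sections

section Forms

variable (E : Type*) [NormedAddCommGroup E] [NormedSpace ℂ E]
  {X : Type*} [TopologicalSpace X] [ChartedSpace E X] [IsManifold 𝓘(ℂ, E) ω X]

/-- The space `Ω¹(U)` of holomorphic `1`-forms on `U`: holomorphic sections of the cotangent
bundle `Hom(TX, ℂ)`. -/
abbrev holForm (U : Opens X) : Type _ :=
  HolSec E (E →L[ℂ] ℂ) (fun x : X => TangentSpace 𝓘(ℂ, E) x →L[ℂ] Bundle.Trivial X ℂ x) U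

variable {E}

open Classical in
/-- Extension by zero of a function on an open subset. -/
def extendZero {U : Opens X} (f : U → ℂ) (x : X) : ℂ := if h : x ∈ U then f ⟨x, h⟩ else 0

theorem extendZero_apply {U : Opens X} (f : U → ℂ) (x : U) : extendZero f x = f x := by
  simp [extendZero]

set_option linter.unusedSectionVars false in
theorem contMDiffOn_extendZero {U : Opens X} (f : holFun E U) :
    ContMDiffOn 𝓘(ℂ, E) 𝓘(ℂ, ℂ) ω (extendZero f.1) U := by
  obtain ⟨t, ht, e⟩ := f.2
  refine ht.congr fun x hx => ?_
  rw [e ⟨x, hx⟩]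
  exact extendZero_apply f.1 ⟨x, hx⟩

theorem mdifferentiableAt_extendZero {U : Opens X} (f : holFun E U) (x : U) :
    MDifferentiableAt 𝓘(ℂ, E) 𝓘(ℂ, ℂ) (extendZero f.1) x :=
  ((contMDiffOn_extendZero f).contMDiffAt (U.2.mem_nhds x.2)).mdifferentiableAt (by simp)

/-- The exterior derivative `d : 𝒪(U) → Ω¹(U)`. -/
def dForm {U : Opens X} (f : holFun E U) : holForm E U :=
  ⟨fun x => (mfderiv 𝓘(ℂ, E) 𝓘(ℂ, ℂ) (extendZero f.1) x : E →L[ℂ] ℂ), by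
    refine ⟨fun x => (mfderiv 𝓘(ℂ, E) 𝓘(ℂ, ℂ) (extendZero f.1) x : E →L[ℂ] ℂ), ?_, fun _ => rfl⟩
    intro x hx
    refine ContMDiffAt.contMDiffWithinAt ?_
    rw [contMDiffAt_hom_bundle]
    refine ⟨contMDiffAt_id, ?_⟩
    have h := ((contMDiffOn_extendZero f).contMDiffAt (U.2.mem_nhds hx)).mfderiv_const
      (m := ω) (by simp)
    refine h.congr_of_eventuallyEq ?_
    refine Filter.Eventually.of_forall fun y => ?_
    ext v
    simp [inTangentCoordinates, ContinuousLinearMap.inCoordinates]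
    rfl⟩

theorem dForm_add {U : Opens X} (f g : holFun E U) : dForm (f + g) = dForm f + dForm g := by
  have h : extendZero (f + g).1 = extendZero f.1 + extendZero g.1 := by
    funext x
    by_cases hx : x ∈ U <;> simp [extendZero, hx]
  ext x v
  change mfderiv 𝓘(ℂ, E) 𝓘(ℂ, ℂ) (extendZero (f + g).1) x.1 v = _
  rw [h, mfderiv_add (mdifferentiableAt_extendZero f x) (mdifferentiableAt_extendZero g x)]
  rfl

theorem dForm_mul {U : Opens X} (f g : holFun E U) :
    dForm (f * g) = f • dForm g + g • dForm f := by
  have h : extendZero (f * g).1 = extendZero f.1 * extendZero g.1 := by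
    funext x
    by_cases hx : x ∈ U <;> simp [extendZero, hx]
  ext x v
  change mfderiv 𝓘(ℂ, E) 𝓘(ℂ, ℂ) (extendZero (f * g).1) x.1 v = _
  rw [h, ((mdifferentiableAt_extendZero f x).hasMFDerivAt.mul
    (mdifferentiableAt_extendZero g x).hasMFDerivAt).mfderiv, extendZero_apply, extendZero_apply]
  rfl

theorem dForm_algebraMap {U : Opens X} (c : ℂ) : dForm (algebraMap ℂ (holFun E U) c) = 0 := by
  ext x v
  change mfderiv 𝓘(ℂ, E) 𝓘(ℂ, ℂ) (extendZero fun _ => c) x.1 v = _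
  have h : (extendZero fun _ : U => c) =ᶠ[𝓝 x.1] fun _ => c := by
    filter_upwards [U.2.mem_nhds x.2] with y hy
    exact extendZero_apply _ ⟨y, hy⟩
  rw [h.mfderiv_eq, mfderiv_const]
  rfl

theorem dForm_res {U W : Opens X} (h : W ≤ U) (f : holFun E U) :
    dForm (holFun.res h f) = HolSec.res h (dForm f) := by
  have e (x : W) : extendZero (holFun.res h f).1 =ᶠ[𝓝 x.1] extendZero f.1 := by
    filter_upwards [W.2.mem_nhds x.2] with y hy
    rw [extendZero_apply (holFun.res h f).1 ⟨y, hy⟩]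
    exact (extendZero_apply f.1 ⟨y, h hy⟩).symm
  ext x v
  change mfderiv 𝓘(ℂ, E) 𝓘(ℂ, ℂ) (extendZero (holFun.res h f).1) x.1 v =
    mfderiv 𝓘(ℂ, E) 𝓘(ℂ, ℂ) (extendZero f.1) x.1 v
  rw [(e x).mfderiv_eq]
  rfl

/-- The logarithmic derivative `g ↦ dg / g` from `𝒪^*(U)` (written additively) to `Ω¹(U)`. -/
def dlog (U : Opens X) : Additive (holFun E U)ˣ →+ holForm E U where
  toFun g := (↑(Additive.toMul g)⁻¹ : holFun E U) • dForm (↑(Additive.toMul g) : holFun E U)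
  map_zero' := by
    have h : dForm (1 : holFun E U) = 0 := by
      simpa using dForm_algebraMap (E := E) (U := U) 1
    simp [h]
  map_add' a b := by
    set u := Additive.toMul a
    set v := Additive.toMul b
    have h₁ : (↑(u * v)⁻¹ : holFun E U) * u = ↑v⁻¹ := by
      rw [mul_inv, Units.val_mul, mul_right_comm, Units.inv_mul, one_mul]
    have h₂ : (↑(u * v)⁻¹ : holFun E U) * v = ↑u⁻¹ := by
      rw [mul_inv, Units.val_mul, mul_assoc, Units.inv_mul, mul_one]
    rw [toMul_add, Units.val_mul, dForm_mul, smul_add, smul_smul, smul_smul, h₁, h₂, add_comm]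

end Forms

section LineBundles

variable (E : Type*) [NormedAddCommGroup E] [NormedSpace ℂ E]
  (X : Type*) [TopologicalSpace X] [ChartedSpace E X]

/-- A holomorphic line bundle on `X`: a complex vector bundle with fibre `ℂ` and holomorphic
(complex analytic) transition functions. -/
structure LineBundle where
  fiber : X → Type
  [addCommGroup : ∀ x, AddCommGroup (fiber x)]
  [module : ∀ x, Module ℂ (fiber x)]
  [topFiber : ∀ x, TopologicalSpace (fiber x)]
  [isTopologicalAddGroup : ∀ x, IsTopologicalAddGroup (fiber x)]
  [continuousSMul : ∀ x, ContinuousSMul ℂ (fiber x)]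
  [topTotal : TopologicalSpace (TotalSpace ℂ fiber)]
  [fiberBundle : FiberBundle ℂ fiber]
  [vectorBundle : VectorBundle ℂ ℂ fiber]
  [holomorphic : ContMDiffVectorBundle ω ℂ fiber 𝓘(ℂ, E)]

attribute [instance] LineBundle.addCommGroup LineBundle.module LineBundle.topFiber
  LineBundle.isTopologicalAddGroup LineBundle.continuousSMul LineBundle.topTotal
  LineBundle.fiberBundle LineBundle.vectorBundle LineBundle.holomorphic

variable {E X}

namespace LineBundle

/-- The sheaf of holomorphic sections of a line bundle, an invertible `𝒪`-module. -/
abbrev sec (L : LineBundle E X) (U : Opens X) : Type _ := HolSec E ℂ L.fiber U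

/-- An isomorphism of holomorphic line bundles: a family of linear isomorphisms of the fibres which
carries holomorphic sections to holomorphic sections, in both directions. -/
structure Iso (L M : LineBundle E X) where
  equiv : ∀ x, L.fiber x ≃ₗ[ℂ] M.fiber x
  map_mem : ∀ (U : Opens X) (s : L.sec U), (fun x : U => equiv x (s.1 x)) ∈ holSec E ℂ M.fiber U
  symm_mem : ∀ (U : Opens X) (s : M.sec U), (fun x : U => (equiv x).symm (s.1 x)) ∈ holSec E ℂ L.fiber U

/-- The map on sections induced by an isomorphism. -/
def Iso.map {L M : LineBundle E X} (φ : Iso L M) {U : Opens X} (s : L.sec U) : M.sec U :=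
  ⟨fun x => φ.equiv x (s.1 x), φ.map_mem U s⟩

/-- `L` and `M` are isomorphic. -/
instance setoid : Setoid (LineBundle E X) where
  r L M := Nonempty (Iso L M)
  iseqv :=
    { refl := fun _ => ⟨⟨fun _ => .refl ℂ _, fun _ s => s.2, fun _ s => s.2⟩⟩
      symm := fun ⟨φ⟩ => ⟨⟨fun x => (φ.equiv x).symm, φ.symm_mem, φ.map_mem⟩⟩
      trans := fun ⟨φ⟩ ⟨ψ⟩ => ⟨⟨fun x => (φ.equiv x).trans (ψ.equiv x),
        fun U s => ψ.map_mem U ⟨_, φ.map_mem U s⟩, fun U s => φ.symm_mem U ⟨_, ψ.symm_mem U s⟩⟩⟩ }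

/-- `N`, together with the pairing `(s, t) ↦ s ⊗ t`, is a tensor product of the line bundles `L` and
`M`: each fibre of `N` is the tensor product of the fibres of `L` and `M`, and `s ⊗ t` is
holomorphic for holomorphic sections `s` and `t`. -/
structure TensorProduct (L M N : LineBundle E X) where
  pair : ∀ x, L.fiber x →ₗ[ℂ] M.fiber x →ₗ[ℂ] N.fiber x
  isTensorProduct : ∀ x, IsTensorProduct (pair x)
  pair_mem : ∀ (U : Opens X) (s : L.sec U) (t : M.sec U),
    (fun x : U => pair x (s.1 x) (t.1 x)) ∈ holSec E ℂ N.fiber U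

/-- The section `s ⊗ t` of the tensor product. -/
def TensorProduct.tmul {L M N : LineBundle E X} (τ : TensorProduct L M N) {U : Opens X}
    (s : L.sec U) (t : M.sec U) : N.sec U :=
  ⟨fun x => τ.pair x (s.1 x) (t.1 x), τ.pair_mem U s t⟩

variable (E X) in
/-- The trivial line bundle, whose sheaf of sections is `𝒪_X`. -/
abbrev trivial : LineBundle E X where
  fiber := Bundle.Trivial X ℂ

end LineBundle

variable (E X) in
/-- The analytic Picard group, as the set of isomorphism classes of holomorphic line bundles. -/
def PicAn := Quotient (LineBundle.setoid (E := E) (X := X))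

/-- The class of a line bundle. -/
def LineBundle.cls (L : LineBundle E X) : PicAn E X := Quotient.mk _ L

variable [IsManifold 𝓘(ℂ, E) ω X]

/-- The module `(Ω¹ ⊗ L)(U)` of holomorphic sections over `U` of the bundle
`T^*X ⊗ L = Hom(TX, L)`. -/
abbrev LineBundle.form (L : LineBundle E X) (U : Opens X) : Type _ :=
  HolSec E (E →L[ℂ] ℂ) (fun x : X => TangentSpace 𝓘(ℂ, E) x →L[ℂ] L.fiber x) U

/-- A holomorphic connection on `L`: a `ℂ`-linear morphism of sheaves `∇ : L → Ω¹ ⊗ L` with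
`∇ (f s) = f ∇ s + df ⊗ s`. The value at `x` of `η ⊗ s` is the linear map `v ↦ η x v • s x`. -/
structure Connection (L : LineBundle E X) where
  nabla : ∀ U : Opens X, L.sec U →ₗ[ℂ] L.form U
  nabla_res : ∀ {U W : Opens X} (h : W ≤ U) (s : L.sec U),
    nabla W (HolSec.res h s) = HolSec.res h (nabla U s)
  leibniz : ∀ {U : Opens X} (f : holFun E U) (s : L.sec U) (x : U)
    (v : TangentSpace 𝓘(ℂ, E) (x : X)),
    (nabla U (f • s)).1 x v = f.1 x • (nabla U s).1 x v + ((dForm f).1 x v : ℂ) • s.1 x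

variable (E X) in
/-- A holomorphic line bundle with a holomorphic connection. -/
structure ConnLineBundle where
  bundle : LineBundle E X
  conn : Connection bundle

namespace ConnLineBundle

/-- An isomorphism of line bundles with connection: an isomorphism `φ` of line bundles with
`∇' (φ s) = (1 ⊗ φ) (∇ s)`. -/
structure Iso (P Q : ConnLineBundle E X) where
  toIso : LineBundle.Iso P.bundle Q.bundle
  comm : ∀ (U : Opens X) (s : P.bundle.sec U) (x : U) (v : TangentSpace 𝓘(ℂ, E) (x : X)),
    (Q.conn.nabla U (toIso.map s)).1 x v = toIso.equiv x ((P.conn.nabla U s).1 x v)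

/-- `P` and `Q` are isomorphic. -/
instance setoid : Setoid (ConnLineBundle E X) where
  r P Q := Nonempty (Iso P Q)
  iseqv :=
    { refl := fun _ => ⟨⟨⟨fun _ => .refl ℂ _, fun _ s => s.2, fun _ s => s.2⟩, fun _ _ _ _ => rfl⟩⟩
      symm := fun {P Q} ⟨φ⟩ => ⟨⟨⟨fun x => (φ.toIso.equiv x).symm, φ.toIso.symm_mem,
        φ.toIso.map_mem⟩, fun U s x v => by
          have h := φ.comm U ⟨_, φ.toIso.symm_mem U s⟩ x v
          have h' : φ.toIso.map ⟨_, φ.toIso.symm_mem U s⟩ = s := by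
            ext y
            simp [LineBundle.Iso.map]
          rw [h'] at h
          rw [h, LinearEquiv.symm_apply_apply]
          rfl⟩⟩
      trans := fun ⟨φ⟩ ⟨ψ⟩ => ⟨⟨⟨fun x => (φ.toIso.equiv x).trans (ψ.toIso.equiv x),
        fun U s => ψ.toIso.map_mem U ⟨_, φ.toIso.map_mem U s⟩,
        fun U s => φ.toIso.symm_mem U ⟨_, ψ.toIso.symm_mem U s⟩⟩, fun U s x v => by
          have h := ψ.comm U (φ.toIso.map s) x v
          rw [φ.comm U s x v] at h
          exact h⟩⟩ }

/-- `R` is a tensor product of `P` and `Q`: the underlying line bundle is a tensor product, and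
`∇ (s ⊗ t) = ∇ s ⊗ t + s ⊗ ∇ t`. -/
structure TensorProduct (P Q R : ConnLineBundle E X) where
  toTensorProduct : LineBundle.TensorProduct P.bundle Q.bundle R.bundle
  nabla_tmul : ∀ (U : Opens X) (s : P.bundle.sec U) (t : Q.bundle.sec U) (x : U)
    (v : TangentSpace 𝓘(ℂ, E) (x : X)),
    (R.conn.nabla U (toTensorProduct.tmul s t)).1 x v =
      toTensorProduct.pair x ((P.conn.nabla U s).1 x v) (t.1 x) +
        toTensorProduct.pair x (s.1 x) ((Q.conn.nabla U t).1 x v)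

end ConnLineBundle

variable (E X) in
/-- The group `Pic_c` of line bundles with connection, as the set of isomorphism classes. -/
def PicC := Quotient (ConnLineBundle.setoid (E := E) (X := X))

/-- The class of a line bundle with connection. -/
def ConnLineBundle.cls (P : ConnLineBundle E X) : PicC E X := Quotient.mk _ P

/-- Forgetting the connection. -/
def forgetConn : PicC E X → PicAn E X :=
  Quotient.map ConnLineBundle.bundle fun _ _ ⟨φ⟩ => ⟨φ.toIso⟩

/-- Sections of the trivial line bundle are holomorphic functions. -/
def trivialToFun {U : Opens X} (f : (LineBundle.trivial E X).sec U) : holFun E U :=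
  ⟨f.1, by
    obtain ⟨t, ht, e⟩ := f.2
    refine ⟨t, fun x hx => ?_, e⟩
    exact (Bundle.contMDiffWithinAt_section (F := ℂ) (E := Bundle.Trivial X ℂ) ..).1 (ht x hx)⟩

theorem trivial_leibniz {U : Opens X} (η : holForm E U) (f g : holFun E U) (x : U)
    (v : TangentSpace 𝓘(ℂ, E) (x : X)) :
    ((dForm (f * g) + (f * g) • η).1 x v : ℂ) =
      f.1 x * (dForm g + g • η).1 x v + (dForm f).1 x v * g.1 x := by
  rw [dForm_mul, mul_smul]
  simp only [HolSec.add_apply, HolSec.smul_apply]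
  change f.1 x * (dForm g).1 x v + g.1 x * (dForm f).1 x v + f.1 x * (g.1 x * η.1 x v) =
    f.1 x * ((dForm g).1 x v + g.1 x * η.1 x v) + (dForm f).1 x v * g.1 x
  ring

/-- The connection `∇ f = df + f η` on the trivial line bundle. -/
def trivialConn (η : holForm E (⊤ : Opens X)) : Connection (LineBundle.trivial E X) where
  nabla U :=
    { toFun := fun f => dForm (trivialToFun f) + trivialToFun f • HolSec.res le_top η
      map_add' := fun f g => by
        have h : trivialToFun (f + g) = trivialToFun f + trivialToFun g := rfl
        rw [h, dForm_add, add_smul]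
        exact add_add_add_comm ..
      map_smul' := fun c f => by
        have h : trivialToFun (c • f) = algebraMap ℂ (holFun E U) c * trivialToFun f := rfl
        rw [h, dForm_mul, dForm_algebraMap, mul_smul, smul_zero, add_zero]
        exact (smul_add (algebraMap ℂ (holFun E U) c) _ _).symm }
  nabla_res := by
    intro U W h s
    have e : trivialToFun (HolSec.res h s) = holFun.res h (trivialToFun s) := rfl
    change dForm (trivialToFun (HolSec.res h s)) + trivialToFun (HolSec.res h s) • _ =
      HolSec.res h (dForm (trivialToFun s) + _)
    rw [map_add, e, dForm_res]
    rfl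
  leibniz := by
    intro U f s x v
    exact trivial_leibniz _ f (trivialToFun s) x v

/-- The map `H⁰(X, Ω¹) → Pic_c(X)`, `η ↦ (𝒪_X, d + η)`. -/
def formToPicC (η : holForm E (⊤ : Opens X)) : PicC E X :=
  ConnLineBundle.cls ⟨LineBundle.trivial E X, trivialConn η⟩

end LineBundles

section Cech

/-- An open covering `(U x)` of `X` indexed by the points of `X`, with `x ∈ U x`. Every open covering
is refined by one of these: choose for each point a member of the covering that contains it. -/
structure PointCover (X : Type*) [TopologicalSpace X] where
  toFun : X → Opens X
  mem : ∀ x, x ∈ toFun x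

/-- `𝒰 ≤ 𝒱` if `𝒱` refines `𝒰`. -/
instance (X : Type*) [TopologicalSpace X] : Preorder (PointCover X) where
  le 𝒰 𝒱 := ∀ x, 𝒱.toFun x ≤ 𝒰.toFun x
  le_refl _ _ := le_rfl
  le_trans _ _ _ h₁ h₂ x := (h₂ x).trans (h₁ x)

variable (E : Type*) [NormedAddCommGroup E] [NormedSpace ℂ E]
  {X : Type*} [TopologicalSpace X] [ChartedSpace E X]
  (F : Type*) [NormedAddCommGroup F] [NormedSpace ℂ F]
  (V : X → Type*) [TopologicalSpace (TotalSpace F V)] [∀ x, AddCommGroup (V x)]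
  [∀ x, Module ℂ (V x)] [∀ x, TopologicalSpace (V x)] [FiberBundle F V] [VectorBundle ℂ F V]

namespace PointCover

/-- The Čech `0`-cochains of `𝒰` with values in the sheaf of holomorphic sections of `V`. -/
abbrev C0 (𝒰 : PointCover X) : Type _ := ∀ i, HolSec E F V (𝒰.toFun i)

/-- The Čech `1`-cochains of `𝒰` with values in the sheaf of holomorphic sections of `V`. -/
abbrev C1 (𝒰 : PointCover X) : Type _ := ∀ i j, HolSec E F V (𝒰.toFun i ⊓ 𝒰.toFun j)

/-- The Čech coboundary `C⁰ → C¹`, `(b i) ↦ (b j - b i)`. -/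
def delta0 (𝒰 : PointCover X) : 𝒰.C0 E F V →+ 𝒰.C1 E F V where
  toFun b i j := HolSec.res inf_le_right (b j) - HolSec.res inf_le_left (b i)
  map_zero' := by
    funext i j
    simp
  map_add' b c := by
    funext i j
    simp only [Pi.add_apply, map_add]
    abel

/-- The Čech cocycles `Z¹`: `c j k - c i k + c i j = 0` on `U i ∩ U j ∩ U k`. -/
def Z1 (𝒰 : PointCover X) : AddSubgroup (𝒰.C1 E F V) where
  carrier := {c | ∀ i j k,
    HolSec.res (W := 𝒰.toFun i ⊓ 𝒰.toFun j ⊓ 𝒰.toFun k)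
        (le_inf (inf_le_left.trans inf_le_right) inf_le_right) (c j k) -
      HolSec.res (le_inf (inf_le_left.trans inf_le_left) inf_le_right) (c i k) +
      HolSec.res inf_le_left (c i j) = 0}
  zero_mem' i j k := by simp
  add_mem' {c d} hc hd i j k := by
    have h := congrArg₂ (· + ·) (hc i j k) (hd i j k)
    simp only [add_zero] at h
    rw [← h]
    simp only [Pi.add_apply, map_add]
    abel
  neg_mem' {c} hc i j k := by
    have h := congrArg (- ·) (hc i j k)
    simp only [neg_zero] at h
    rw [← h]
    simp only [Pi.neg_apply, map_neg]
    abel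

/-- The first Čech cohomology group of the covering `𝒰`: cocycles modulo coboundaries. -/
def H1 (𝒰 : PointCover X) : Type _ :=
  𝒰.Z1 E F V ⧸ (𝒰.delta0 E F V).range.addSubgroupOf (𝒰.Z1 E F V)

instance (𝒰 : PointCover X) : AddCommGroup (𝒰.H1 E F V) :=
  inferInstanceAs (AddCommGroup (𝒰.Z1 E F V ⧸ (𝒰.delta0 E F V).range.addSubgroupOf (𝒰.Z1 E F V)))

/-- The class of a cocycle in the first Čech cohomology group of the covering. -/
def toH1 (𝒰 : PointCover X) : 𝒰.Z1 E F V →+ 𝒰.H1 E F V :=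
  QuotientAddGroup.mk' ((𝒰.delta0 E F V).range.addSubgroupOf (𝒰.Z1 E F V))

/-- Restriction of cochains to a finer covering. -/
def resC1 {𝒰 𝒱 : PointCover X} (h : 𝒰 ≤ 𝒱) : 𝒰.C1 E F V →+ 𝒱.C1 E F V where
  toFun c i j := HolSec.res (inf_le_inf (h i) (h j)) (c i j)
  map_zero' := rfl
  map_add' _ _ := rfl

/-- Restriction of cocycles to a finer covering. -/
def resZ1 {𝒰 𝒱 : PointCover X} (h : 𝒰 ≤ 𝒱) : 𝒰.Z1 E F V →+ 𝒱.Z1 E F V :=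
  ((resC1 E F V h).comp (𝒰.Z1 E F V).subtype).codRestrict (𝒱.Z1 E F V) fun c i j k =>
    congrArg (HolSec.res (inf_le_inf (inf_le_inf (h i) (h j)) (h k))) (c.2 i j k)

/-- The refinement map on Čech cohomology. -/
def resH1 (𝒰 𝒱 : PointCover X) (h : 𝒰 ≤ 𝒱) : 𝒰.H1 E F V →+ 𝒱.H1 E F V :=
  QuotientAddGroup.map ((𝒰.delta0 E F V).range.addSubgroupOf (𝒰.Z1 E F V))
    ((𝒱.delta0 E F V).range.addSubgroupOf (𝒱.Z1 E F V)) (resZ1 E F V h) <| by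
    rintro ⟨c, hc⟩ ⟨b, hb⟩
    refine ⟨fun i => HolSec.res (h i) (b i), ?_⟩
    exact congrArg (resC1 E F V h) hb

end PointCover

open Classical in
/-- The first cohomology group of `X` with values in the sheaf of holomorphic sections of `V`:
the direct limit of the first Čech cohomology groups over all open coverings. -/
def SheafH1 : Type _ :=
  AddCommGroup.DirectLimit (fun 𝒰 : PointCover X => 𝒰.H1 E F V) (PointCover.resH1 E F V)

open Classical in
instance : AddCommGroup (SheafH1 E F V) :=
  inferInstanceAs (AddCommGroup
    (AddCommGroup.DirectLimit (fun 𝒰 : PointCover X => 𝒰.H1 E F V) (PointCover.resH1 E F V)))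

variable {E F V} in
open Classical in
/-- The class of a Čech cocycle. -/
def cechClass {𝒰 : PointCover X} (c : 𝒰.Z1 E F V) : SheafH1 E F V :=
  AddCommGroup.DirectLimit.of (fun 𝒰 : PointCover X => 𝒰.H1 E F V) (PointCover.resH1 E F V) 𝒰
    (𝒰.toH1 E F V c)

end Cech

section AtiyahClass

variable (E : Type*) [NormedAddCommGroup E] [NormedSpace ℂ E]
  (X : Type*) [TopologicalSpace X] [ChartedSpace E X] [IsManifold 𝓘(ℂ, E) ω X]

/-- The cohomology group `H¹(X, Ω¹)`. -/
abbrev H1Form : Type _ :=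
  SheafH1 E (E →L[ℂ] ℂ) (fun x : X => TangentSpace 𝓘(ℂ, E) x →L[ℂ] Bundle.Trivial X ℂ x)

variable {E X}

/-- The group of Čech cocycles `Z¹(𝒰, Ω¹)`. -/
abbrev Z1Form (𝒰 : PointCover X) :=
  𝒰.Z1 E (E →L[ℂ] ℂ) (fun x : X => TangentSpace 𝓘(ℂ, E) x →L[ℂ] Bundle.Trivial X ℂ x)

/-- Local trivializations of `L`: an open covering `(U i)`, nowhere vanishing holomorphic sections
`s i` of `L` over `U i`, and the transition functions `g i j` in `𝒪^*(U i ∩ U j)`, with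
`s j = g i j • s i` on `U i ∩ U j`. -/
structure LocalFrames (L : LineBundle E X) where
  cover : PointCover X
  frame : ∀ i, L.sec (cover.toFun i)
  frame_ne_zero : ∀ i x, (frame i).1 x ≠ 0
  trans : ∀ i j, (holFun E (cover.toFun i ⊓ cover.toFun j))ˣ
  frame_eq : ∀ i j, HolSec.res inf_le_right (frame j) =
    (trans i j : holFun E (cover.toFun i ⊓ cover.toFun j)) • HolSec.res inf_le_left (frame i)

/-- The Čech cochain `(dg_ij / g_ij)`. -/
def LocalFrames.dlogTrans {L : LineBundle E X} (T : LocalFrames L) (i j : X) :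
    holForm E (T.cover.toFun i ⊓ T.cover.toFun j) :=
  dlog _ (Additive.ofMul (T.trans i j))

end AtiyahClass

end HolLine

end

/-! Everything is read off from Čech data. Frames e_i of L over a covering have transition functions
g_ij with e_j = g_ij e_i, and these form a multiplicative cocycle. A connection is determined by its
forms η_i, where ∇ e_i = η_i ⊗ e_i. Applying ∇ to e_j = g_ij e_i gives dg_ij / g_ij = η_j - η_i
(`ConnFraming.dlog_eq_delta`). Conversely, forms with this property define a connection
(`Framing.connection`), because the local formulas f e_i ↦ (df + f η_i) ⊗ e_i agree on overlaps
(`Framing.nablaAt_eq`).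

Objects with equal data are isomorphic (`Framing.iso`, `ConnFraming.iso`), tensor products multiply
the g_ij and add the η_i, and every cocycle comes from a line bundle (`IsCocycle.framing`). The
purely formal `exists_addCommGroup_quotient` turns these facts into both group structures.

Replacing the frames e_i by u_i e_i changes dlog g by the coboundary of dlog u, so its class in H¹
depends only on L (`Framing.atiyahClass_eq`). The class vanishes exactly when dlog g = δη on some
finer covering, that is, when L has a connection (`LineBundle.nonempty_connection_iff`); this is
exactness at Pic. At Pic_c, a global frame of a trivial bundle turns the connection into d + η. At
H⁰(Ω¹), an isomorphism from (𝒪, d + η) to (𝒪, d) is multiplication by a unit u, and compatibility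
with the connections on the section 1 reads du = u η. -/

noncomputable section

namespace HolLine

/-! ### Holomorphy of sections is a local condition. -/

section LocalCriteria

variable {E : Type*} [NormedAddCommGroup E] [NormedSpace ℂ E]
  {X : Type*} [TopologicalSpace X] [ChartedSpace E X]
  {F : Type*} [NormedAddCommGroup F] [NormedSpace ℂ F]
  {V : X → Type*} [TopologicalSpace (TotalSpace F V)] [∀ x, AddCommGroup (V x)]
  [∀ x, Module ℂ (V x)] [∀ x, TopologicalSpace (V x)] [FiberBundle F V] [VectorBundle ℂ F V]

/-- Since U is open, holomorphy on U is holomorphy at each of its points; the pointwise form is the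
one that the criteria for hom bundles and trivializations accept. -/
theorem HolSec.exists_contMDiffAt {U : Opens X} (s : HolSec E F V U) :
    ∃ t : ∀ x, V x, (∀ x ∈ U, ContMDiffAt 𝓘(ℂ, E) (𝓘(ℂ, E).prod 𝓘(ℂ, F)) ω
      (fun x => TotalSpace.mk' F x (t x)) x) ∧ ∀ x (hx : x ∈ U), t x = s.1 ⟨x, hx⟩ := by
  obtain ⟨t, ht, e⟩ := s.2
  exact ⟨t, fun x hx => ht.contMDiffAt (U.2.mem_nhds hx), fun x hx => e ⟨x, hx⟩⟩

open Classical in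
/-- A section which is holomorphic near every point is holomorphic. -/
theorem mem_holSec_of_contMDiffAt {U : Opens X} {s : ∀ x : U, V x}
    (h : ∀ x ∈ U, ∃ t : ∀ x, V x, ContMDiffAt 𝓘(ℂ, E) (𝓘(ℂ, E).prod 𝓘(ℂ, F)) ω
      (fun x => TotalSpace.mk' F x (t x)) x ∧ ∀ᶠ y in 𝓝 x, ∀ hy : y ∈ U, t y = s ⟨y, hy⟩) :
    s ∈ holSec E F V U := by
  refine ⟨fun x => if hx : x ∈ U then s ⟨x, hx⟩ else 0, fun x hx => ?_, fun x => by simp⟩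
  obtain ⟨t, ht, e⟩ := h x hx
  refine (ht.congr_of_eventuallyEq ?_).contMDiffWithinAt
  filter_upwards [e, U.2.mem_nhds hx] with y hy hyU
  rw [hy hyU, dif_pos (show y ∈ U from hyU)]

/-- Holomorphic sections form a sheaf: gluing. -/
theorem mem_holSec_of_local {U : Opens X} {s : ∀ x : U, V x}
    (h : ∀ x ∈ U, ∃ W : Opens X, x ∈ W ∧ ∃ t : HolSec E F V W,
      ∀ y (hU : y ∈ U) (hW : y ∈ W), t.1 ⟨y, hW⟩ = s ⟨y, hU⟩) :
    s ∈ holSec E F V U := by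
  refine mem_holSec_of_contMDiffAt fun x hx => ?_
  obtain ⟨W, hxW, t, ht⟩ := h x hx
  obtain ⟨t', ht', e⟩ := t.exists_contMDiffAt
  refine ⟨t', ht' x hxW, ?_⟩
  filter_upwards [W.2.mem_nhds hxW] with y hy hyU
  rw [e y hy, ht y hyU hy]

end LocalCriteria

/-! ### Holomorphic functions and units. -/

section Functions

variable {E : Type*} [NormedAddCommGroup E] [NormedSpace ℂ E]
  {X : Type*} [TopologicalSpace X] [ChartedSpace E X]

theorem mem_holFun_of_contMDiffAt {U : Opens X} {f : U → ℂ}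
    (h : ∀ x ∈ U, ∃ t : X → ℂ, ContMDiffAt 𝓘(ℂ, E) 𝓘(ℂ, ℂ) ω t x ∧
      ∀ᶠ y in 𝓝 x, ∀ hy : y ∈ U, t y = f ⟨y, hy⟩) :
    f ∈ holFun E U := by
  refine ⟨extendZero f, fun x hx => ?_, fun x => extendZero_apply f x⟩
  obtain ⟨t, ht, e⟩ := h x hx
  refine (ht.congr_of_eventuallyEq ?_).contMDiffWithinAt
  filter_upwards [e, U.2.mem_nhds hx] with y hy hyU
  rw [hy hyU]
  exact extendZero_apply f ⟨y, hyU⟩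

theorem holFun.exists_contMDiffAt {U : Opens X} (f : holFun E U) :
    ∃ t : X → ℂ, (∀ x ∈ U, ContMDiffAt 𝓘(ℂ, E) 𝓘(ℂ, ℂ) ω t x) ∧
      ∀ x (hx : x ∈ U), t x = f.1 ⟨x, hx⟩ := by
  obtain ⟨t, ht, e⟩ := f.2
  exact ⟨t, fun x hx => ht.contMDiffAt (U.2.mem_nhds hx), fun x hx => e ⟨x, hx⟩⟩

/-- A nowhere vanishing holomorphic function is a unit. -/
def unitOfNeZero {U : Opens X} (f : holFun E U) (hf : ∀ x, f.1 x ≠ 0) : (holFun E U)ˣ where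
  val := f
  inv := ⟨fun x => (f.1 x)⁻¹, mem_holFun_of_contMDiffAt fun x hx => by
    obtain ⟨t, ht, e⟩ := holFun.exists_contMDiffAt f
    refine ⟨fun y => (t y)⁻¹, (ht x hx).inv₀ (by rw [e x hx]; exact hf _), ?_⟩
    exact Filter.Eventually.of_forall fun y hy => congrArg (·⁻¹) (e y hy)⟩
  val_inv := Subtype.ext (funext fun x => mul_inv_cancel₀ (hf x))
  inv_val := Subtype.ext (funext fun x => inv_mul_cancel₀ (hf x))

theorem unit_mul_inv_apply {U : Opens X} (g : (holFun E U)ˣ) (x : U) :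
    g.val.1 x * (↑g⁻¹ : holFun E U).1 x = 1 :=
  congrFun (congrArg Subtype.val g.mul_inv) x

theorem unit_ne_zero {U : Opens X} (g : (holFun E U)ˣ) (x : U) : g.val.1 x ≠ 0 :=
  left_ne_zero_of_mul_eq_one (unit_mul_inv_apply g x)

theorem unit_ext {U : Opens X} {g h : (holFun E U)ˣ} (e : ∀ x, g.val.1 x = h.val.1 x) : g = h :=
  Units.ext (Subtype.ext (funext e))

theorem unit_inv_apply {U : Opens X} (g : (holFun E U)ˣ) (x : U) :
    (↑g⁻¹ : holFun E U).1 x = (g.val.1 x)⁻¹ :=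
  eq_inv_of_mul_eq_one_right (unit_mul_inv_apply g x)

end Functions

/-! ### Quotients of sections of a line bundle. -/

section Ratio

variable {E : Type*} [NormedAddCommGroup E] [NormedSpace ℂ E]
  {X : Type*} [TopologicalSpace X] [ChartedSpace E X] {L M N : LineBundle E X}

namespace LineBundle

/-- The coordinate on the fibre `L x` given by the preferred trivialization at `x`. -/
def coord (L : LineBundle E X) (x : X) : L.fiber x ≃L[ℂ] ℂ :=
  (trivializationAt ℂ L.fiber x).continuousLinearEquivAt ℂ x
    (mem_baseSet_trivializationAt ℂ L.fiber x)

/-- The linear form on `L x` which takes the value `1` at the nonzero vector `e`. -/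
def ratio {x : X} (e : L.fiber x) : L.fiber x →L[ℂ] ℂ :=
  (L.coord x e)⁻¹ • (L.coord x : L.fiber x →L[ℂ] ℂ)

theorem ratio_apply {x : X} (e a : L.fiber x) : ratio e a = (L.coord x e)⁻¹ * L.coord x a := rfl

theorem ratio_self {x : X} {e : L.fiber x} (he : e ≠ 0) : ratio e e = 1 := by
  rw [ratio_apply, inv_mul_cancel₀]
  simpa using he

theorem ratio_smul_self {x : X} {e : L.fiber x} (he : e ≠ 0) (c : ℂ) : ratio e (c • e) = c := by
  rw [map_smul, ratio_self he, smul_eq_mul, mul_one]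

theorem ratio_smul {x : X} {e : L.fiber x} (he : e ≠ 0) (a : L.fiber x) : ratio e a • e = a := by
  apply (L.coord x).injective
  have : L.coord x e ≠ 0 := by simpa using he
  rw [map_smul, ratio_apply, smul_eq_mul]
  field_simp

theorem smul_right_inj_of_ne {x : X} {e : L.fiber x} (he : e ≠ 0) {c d : ℂ} (h : c • e = d • e) :
    c = d := by
  rw [← ratio_smul_self he c, h, ratio_smul_self he]

/-- Apply the linear coordinate to a = (ratio e a) • e. Hence the quotient a / e does not depend on
the coordinate used to define it, and near x₀ it can be computed in one fixed trivialization,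
although `coord` changes with the point. -/
theorem trivializationAt_ratio {x₀ x : X} (hx : x ∈ (trivializationAt ℂ L.fiber x₀).baseSet)
    {e : L.fiber x} (he : e ≠ 0) (a : L.fiber x) :
    (trivializationAt ℂ L.fiber x₀ ⟨x, e⟩).2 ≠ 0 ∧
    ratio e a = (trivializationAt ℂ L.fiber x₀ ⟨x, a⟩).2 *
      ((trivializationAt ℂ L.fiber x₀ ⟨x, e⟩).2)⁻¹ := by
  set φ := (trivializationAt ℂ L.fiber x₀).continuousLinearEquivAt ℂ x hx
  have h (b : L.fiber x) : (trivializationAt ℂ L.fiber x₀ ⟨x, b⟩).2 = φ b := rfl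
  have h0 : φ e ≠ 0 := by simpa using he
  refine ⟨h0, ?_⟩
  rw [h, h]
  nth_rw 2 [← ratio_smul he a]
  rw [map_smul, smul_eq_mul, mul_assoc, mul_inv_cancel₀ h0, mul_one]

theorem ratio_mem {U : Opens X} (e s : L.sec U) (he : ∀ x, e.1 x ≠ 0) :
    (fun x : U => ratio (e.1 x) (s.1 x)) ∈ holFun E U := by
  refine mem_holFun_of_contMDiffAt fun x hx => ?_
  obtain ⟨e', he', ee⟩ := e.exists_contMDiffAt
  obtain ⟨s', hs', es⟩ := s.exists_contMDiffAt
  have hb := mem_baseSet_trivializationAt ℂ L.fiber x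
  have h1 := (contMDiffAt_section x).1 (he' x hx)
  have h2 := (contMDiffAt_section x).1 (hs' x hx)
  refine ⟨_, h2.mul (h1.inv₀ ?_), ?_⟩
  · rw [ee x hx]
    exact (trivializationAt_ratio hb (he ⟨x, hx⟩) (e.1 ⟨x, hx⟩)).1
  · filter_upwards [(trivializationAt ℂ L.fiber x).open_baseSet.mem_nhds hb] with y hy hyU
    rw [Pi.mul_apply, es y hyU, ee y hyU]
    exact (trivializationAt_ratio hy (he ⟨y, hyU⟩) (s.1 ⟨y, hyU⟩)).2.symm

/-- The coefficient of the section `s` with respect to the frame `e`. -/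
def coeff {U W : Opens X} (e : L.sec U) (he : ∀ x, e.1 x ≠ 0) (s : L.sec W) : holFun E (W ⊓ U) :=
  ⟨fun x => ratio (e.1 ⟨x, x.2.2⟩) (s.1 ⟨x, x.2.1⟩),
    ratio_mem (HolSec.res inf_le_right e) (HolSec.res inf_le_left s) fun x => he ⟨x, x.2.2⟩⟩

theorem coeff_smul {U W : Opens X} (e : L.sec U) (he : ∀ x, e.1 x ≠ 0) (s : L.sec W) :
    coeff e he s • HolSec.res inf_le_right e = HolSec.res inf_le_left s :=
  HolSec.ext fun x => ratio_smul (he ⟨x, x.2.2⟩) _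

/-- Every point has a neighbourhood with a holomorphic frame. -/
theorem exists_frame (L : LineBundle E X) (x : X) :
    ∃ U : Opens X, x ∈ U ∧ ∃ e : L.sec U, ∀ y, e.1 y ≠ 0 := by
  set T := trivializationAt ℂ L.fiber x
  have key : ∀ y (hy : y ∈ T.baseSet), T ⟨y, T.symm y 1⟩ = (y, (1 : ℂ)) := fun y hy =>
    T.apply_mk_symm hy 1
  refine ⟨⟨T.baseSet, T.open_baseSet⟩, mem_baseSet_trivializationAt ℂ L.fiber x,
    ⟨fun y => T.symm y 1, fun y => T.symm y 1, ?_, fun _ => rfl⟩, fun y h => ?_⟩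
  · intro y hy
    refine ContMDiffAt.contMDiffWithinAt ?_
    rw [T.contMDiffAt_section_iff hy]
    refine (contMDiffAt_const (c := (1 : ℂ))).congr_of_eventuallyEq ?_
    filter_upwards [T.open_baseSet.mem_nhds hy] with z hz
    rw [key z hz]
  · have h1 := key y y.2
    change T.symm y 1 = 0 at h
    rw [h] at h1
    have h2 := congrArg Prod.snd (T.zeroSection ℂ y.2)
    change (T ⟨y, 0⟩).2 = 0 at h2
    rw [h1] at h2
    exact one_ne_zero h2

end LineBundle

end Ratio

/-! ### Forms with values in a line bundle. -/

section FormRatio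

variable {E : Type*} [NormedAddCommGroup E] [NormedSpace ℂ E]
  {X : Type*} [TopologicalSpace X] [ChartedSpace E X] [IsManifold 𝓘(ℂ, E) ω X]
  {L M N : LineBundle E X}

namespace LineBundle

/-- In local trivializations the tensor product η ⊗ a becomes a product of coordinates. Holomorphy
of η ⊗ a, and of η when η ⊗ a and a are given with a nonzero, is thereby reduced to products and
quotients of holomorphic maps. -/
theorem inCoordinates_eq_smul {x₀ x : X} (hx : x ∈ (trivializationAt ℂ L.fiber x₀).baseSet)
    (θ : TangentSpace 𝓘(ℂ, E) x →L[ℂ] L.fiber x)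
    (η : TangentSpace 𝓘(ℂ, E) x →L[ℂ] Bundle.Trivial X ℂ x) (a : L.fiber x)
    (h : ∀ v, θ v = (η v : ℂ) • a) :
    ContinuousLinearMap.inCoordinates E (TangentSpace 𝓘(ℂ, E)) ℂ L.fiber x₀ x x₀ x θ =
      (trivializationAt ℂ L.fiber x₀ ⟨x, a⟩).2 •
        ContinuousLinearMap.inCoordinates E (TangentSpace 𝓘(ℂ, E)) ℂ (Bundle.Trivial X ℂ)
          x₀ x x₀ x η := by
  ext v
  set w := (trivializationAt E (TangentSpace 𝓘(ℂ, E)) x₀).symmL ℂ x v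
  have hη : ContinuousLinearMap.inCoordinates E (TangentSpace 𝓘(ℂ, E)) ℂ (Bundle.Trivial X ℂ)
      x₀ x x₀ x η v = η w := by
    simp [ContinuousLinearMap.inCoordinates, w]
  rw [smul_apply, hη]
  change (trivializationAt ℂ L.fiber x₀).continuousLinearMapAt ℂ x (θ w) =
    (trivializationAt ℂ L.fiber x₀ ⟨x, a⟩).2 * (η w : ℂ)
  rw [h, map_smul, Trivialization.continuousLinearMapAt_apply,
    Trivialization.linearMapAt_apply, if_pos hx, smul_eq_mul, mul_comm]

/-- The section `η ⊗ a` of `Ω¹ ⊗ L`. -/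
def formTensor {U : Opens X} (η : holForm E U) (a : L.sec U) : L.form U :=
  ⟨fun x => ContinuousLinearMap.smulRight (M₁ := TangentSpace 𝓘(ℂ, E) (x : X)) (M₂ := L.fiber x)
      (c := η.1 x) (a.1 x), mem_holSec_of_contMDiffAt fun x hx => by
    obtain ⟨η', hη', eη⟩ := η.exists_contMDiffAt
    obtain ⟨a', ha', ea⟩ := a.exists_contMDiffAt
    refine ⟨fun y => ContinuousLinearMap.smulRight (M₁ := TangentSpace 𝓘(ℂ, E) y)
      (M₂ := L.fiber y) (c := η' y) (a' y), ?_, Filter.Eventually.of_forall fun y hy => ?_⟩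
    · rw [contMDiffAt_hom_bundle]
      refine ⟨contMDiffAt_id, ?_⟩
      have h1 := (contMDiffAt_section x).1 (ha' x hx)
      have h2 := ((contMDiffAt_hom_bundle _).1 (hη' x hx)).2
      refine (h1.smul h2).congr_of_eventuallyEq ?_
      filter_upwards [(trivializationAt ℂ L.fiber x).open_baseSet.mem_nhds
        (mem_baseSet_trivializationAt ℂ L.fiber x)] with y hy
      exact inCoordinates_eq_smul hy _ (η' y) (a' y) fun v => rfl
    · exact congrArg₂ (fun c a => ContinuousLinearMap.smulRight (M₁ := TangentSpace 𝓘(ℂ, E) y)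
        (M₂ := L.fiber y) c a) (eη y hy) (ea y hy)⟩

/-- The `1`-form `η` with `θ = η ⊗ e`, where `e` is a frame. -/
def formRatio {U : Opens X} (e : L.sec U) (he : ∀ x, e.1 x ≠ 0) (θ : L.form U) : holForm E U :=
  ⟨fun x => (ratio (e.1 x)).comp (θ.1 x), mem_holSec_of_contMDiffAt fun x hx => by
    obtain ⟨θ', hθ', eθ⟩ := θ.exists_contMDiffAt
    obtain ⟨e', he', ee⟩ := e.exists_contMDiffAt
    refine ⟨fun y => (ratio (e' y)).comp (θ' y), ?_, Filter.Eventually.of_forall fun y hy => ?_⟩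
    · rw [contMDiffAt_hom_bundle]
      refine ⟨contMDiffAt_id, ?_⟩
      have h1 := (contMDiffAt_section x).1 (he' x hx)
      have h2 := ((contMDiffAt_hom_bundle _).1 (hθ' x hx)).2
      have hb := mem_baseSet_trivializationAt ℂ L.fiber x
      refine ((h1.inv₀ ?_).smul h2).congr_of_eventuallyEq ?_
      · rw [ee x hx]
        exact (trivializationAt_ratio hb (he ⟨x, hx⟩) (e.1 ⟨x, hx⟩)).1
      · filter_upwards [(trivializationAt ℂ L.fiber x).open_baseSet.mem_nhds hb,
          U.2.mem_nhds hx] with y hy hyU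
        have hne : e' y ≠ 0 := by
          rw [ee y hyU]
          exact he _
        have h3 := inCoordinates_eq_smul hy (θ' y) ((ratio (e' y)).comp (θ' y)) (e' y)
          fun v => (ratio_smul hne _).symm
        -- The coordinate of θ = η ⊗ e is that of e times that of η; dividing by the first, which is
        -- nonzero, leaves the second.
        refine Eq.trans (inv_smul_smul₀ (trivializationAt_ratio hy hne (e' y)).1 _).symm ?_
        exact congrArg (fun z => ((trivializationAt ℂ L.fiber x ⟨y, e' y⟩).2)⁻¹ • z) h3.symm
    · exact congrArg₂ (fun (a : L.fiber y) (c : TangentSpace 𝓘(ℂ, E) y →L[ℂ] L.fiber y) =>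
        (ratio a).comp c) (ee y hy) (eθ y hy)⟩

theorem formRatio_apply_smul {U : Opens X} (e : L.sec U) (he : ∀ x, e.1 x ≠ 0) (θ : L.form U)
    (x : U) (v : TangentSpace 𝓘(ℂ, E) (x : X)) :
    ((formRatio e he θ).1 x v : ℂ) • e.1 x = θ.1 x v :=
  ratio_smul (he x) _

end LineBundle

end FormRatio

/-! ### Linear and bilinear maps between one-dimensional fibres. -/

section FibreMaps

variable {E : Type*} [NormedAddCommGroup E] [NormedSpace ℂ E]
  {X : Type*} [TopologicalSpace X] [ChartedSpace E X] {L M N : LineBundle E X}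

namespace LineBundle

/-- The isomorphism of fibres which carries `e` to `f`. -/
def fiberEquiv {x : X} {e : L.fiber x} {f : M.fiber x} (he : e ≠ 0) (hf : f ≠ 0) :
    L.fiber x ≃ₗ[ℂ] M.fiber x where
  toFun a := ratio e a • f
  invFun b := ratio f b • e
  map_add' a b := by rw [map_add, add_smul]
  map_smul' c a := by rw [map_smul, smul_assoc, RingHom.id_apply]
  left_inv a := by
    change ratio f (ratio e a • f) • e = a
    rw [ratio_smul_self hf, ratio_smul he]
  right_inv b := by
    change ratio e (ratio f b • e) • f = b
    rw [ratio_smul_self he, ratio_smul hf]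

theorem ratio_smul_left {x : X} {e : L.fiber x} (he : e ≠ 0) {c : ℂ} (hc : c ≠ 0) (a : L.fiber x) :
    ratio (c • e) a = c⁻¹ * ratio e a := by
  nth_rw 1 [← ratio_smul he a]
  have hce : c • e ≠ 0 := smul_ne_zero hc he
  have : ratio e a • e = (c⁻¹ * ratio e a) • c • e := by
    rw [smul_smul, mul_right_comm, inv_mul_cancel₀ hc, one_mul]
  rw [this, ratio_smul_self hce]

/-- The bilinear pairing of fibres which carries `(e, f)` to `n`. -/
def fiberPair {x : X} (e : L.fiber x) (f : M.fiber x) (n : N.fiber x) :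
    L.fiber x →ₗ[ℂ] M.fiber x →ₗ[ℂ] N.fiber x :=
  LinearMap.mk₂ ℂ (fun a b => (ratio e a * ratio f b) • n)
    (fun a a' b => by rw [map_add, add_mul, add_smul])
    (fun c a b => by rw [map_smul, smul_eq_mul, mul_assoc, mul_smul])
    (fun a b b' => by rw [map_add, mul_add, add_smul])
    (fun c a b => by rw [map_smul, smul_eq_mul, mul_left_comm, mul_smul])

theorem fiberPair_apply {x : X} (e : L.fiber x) (f : M.fiber x) (n : N.fiber x) (a : L.fiber x)
    (b : M.fiber x) : fiberPair e f n a b = (ratio e a * ratio f b) • n := rfl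

instance (x : X) : FiniteDimensional ℂ (L.fiber x) :=
  (L.coord x).symm.toLinearEquiv.finiteDimensional

theorem finrank_fiber (x : X) : Module.finrank ℂ (L.fiber x) = 1 := by
  rw [(L.coord x).toLinearEquiv.finrank_eq, Module.finrank_self]

/-- Source and target of the induced linear map are one-dimensional, so surjectivity is enough, and
(c • e) ⊗ f is sent to c • n. -/
theorem isTensorProduct_fiberPair {x : X} {e : L.fiber x} {f : M.fiber x} {n : N.fiber x}
    (he : e ≠ 0) (hf : f ≠ 0) (hn : n ≠ 0) : IsTensorProduct (fiberPair e f n) := by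
  have hs : Function.Surjective (_root_.TensorProduct.lift (fiberPair e f n)) := fun b => by
    refine ⟨(ratio n b • e) ⊗ₜ[ℂ] f, ?_⟩
    rw [_root_.TensorProduct.lift.tmul, fiberPair_apply, ratio_smul_self he, ratio_self hf, mul_one,
      ratio_smul hn]
  refine ⟨(LinearMap.injective_iff_surjective_of_finrank_eq_finrank ?_).2 hs, hs⟩
  rw [Module.finrank_tensorProduct, finrank_fiber, finrank_fiber, finrank_fiber]

/-- As e and f span their fibres, a pairing that kills (e, f) is zero, which contradicts
surjectivity onto a nonzero fibre. -/
theorem pair_ne_zero {x : X} {p : L.fiber x →ₗ[ℂ] M.fiber x →ₗ[ℂ] N.fiber x}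
    (hp : IsTensorProduct p) {e : L.fiber x} {f : M.fiber x} (he : e ≠ 0) (hf : f ≠ 0) :
    p e f ≠ 0 := by
  intro h
  have h0 : p = 0 := by
    ext a b
    rw [← ratio_smul he a, ← ratio_smul hf b]
    simp [h]
  obtain ⟨z, hz⟩ := hp.2 ((N.coord x).symm 1)
  have : _root_.TensorProduct.lift p = 0 := by
    rw [h0]
    ext
    rfl
  rw [this] at hz
  simpa using hz.symm

end LineBundle

end FibreMaps

/-! ### Frames and transition functions. -/

section Framings

variable {E : Type*} [NormedAddCommGroup E] [NormedSpace ℂ E]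
  {X : Type*} [TopologicalSpace X] [ChartedSpace E X] {L M N : LineBundle E X}

/-- Restriction of invertible holomorphic functions. -/
def unitRes {U W : Opens X} (h : W ≤ U) (g : Additive (holFun E U)ˣ) : Additive (holFun E W)ˣ :=
  Additive.ofMul
    { val := holFun.res h g.toMul
      inv := holFun.res h ↑(g.toMul)⁻¹
      val_inv := Subtype.ext (funext fun _ => congrFun (congrArg Subtype.val g.toMul.mul_inv) _)
      inv_val := Subtype.ext (funext fun _ => congrFun (congrArg Subtype.val g.toMul.inv_mul) _) }

variable (E) in
/-- Transition functions for the covering `𝒰`, without the cocycle condition. -/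
abbrev Trans (𝒰 : PointCover X) : Type _ :=
  ∀ i j, Additive (holFun E (𝒰.toFun i ⊓ 𝒰.toFun j))ˣ

variable {𝒰 𝒱 : PointCover X}

/-- The value at `x` of the transition function `g i j`. -/
def transVal (g : Trans E 𝒰) (i j x : X) (hi : x ∈ 𝒰.toFun i) (hj : x ∈ 𝒰.toFun j) : ℂ :=
  (g i j).toMul.val.1 ⟨x, hi, hj⟩

theorem transVal_add (g h : Trans E 𝒰) (i j x : X) (hi : x ∈ 𝒰.toFun i) (hj : x ∈ 𝒰.toFun j) :
    transVal (g + h) i j x hi hj = transVal g i j x hi hj * transVal h i j x hi hj := rfl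

theorem transVal_neg (g : Trans E 𝒰) (i j x : X) (hi : x ∈ 𝒰.toFun i) (hj : x ∈ 𝒰.toFun j) :
    transVal (-g) i j x hi hj = (transVal g i j x hi hj)⁻¹ := unit_inv_apply _ _

theorem transVal_zero (i j x : X) (hi : x ∈ 𝒰.toFun i) (hj : x ∈ 𝒰.toFun j) :
    transVal (0 : Trans E 𝒰) i j x hi hj = 1 := rfl

theorem transVal_ne_zero (g : Trans E 𝒰) (i j x : X) (hi : x ∈ 𝒰.toFun i) (hj : x ∈ 𝒰.toFun j) :
    transVal g i j x hi hj ≠ 0 := unit_ne_zero _ _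

/-- Restriction of transition functions to a finer covering. -/
def transRes (h : 𝒰 ≤ 𝒱) (g : Trans E 𝒰) : Trans E 𝒱 := fun i j =>
  unitRes (inf_le_inf (h i) (h j)) (g i j)

/-- The cocycle condition. -/
def IsCocycle (g : Trans E 𝒰) : Prop :=
  ∀ i j k x hi hj hk,
    transVal g i k x hi hk = transVal g i j x hi hj * transVal g j k x hj hk

theorem IsCocycle.add {g h : Trans E 𝒰} (hg : IsCocycle g) (hh : IsCocycle h) :
    IsCocycle (g + h) := fun i j k x hi hj hk => by
  simp only [transVal_add, hg i j k x hi hj hk, hh i j k x hi hj hk]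
  ring

theorem IsCocycle.neg {g : Trans E 𝒰} (hg : IsCocycle g) : IsCocycle (-g) :=
  fun i j k x hi hj hk => by
  simp only [transVal_neg, hg i j k x hi hj hk, mul_inv]

/-- The cocycle condition makes g_ii equal to its square, and it is nonzero. -/
theorem IsCocycle.self {g : Trans E 𝒰} (hg : IsCocycle g) (i x : X) (hi : x ∈ 𝒰.toFun i) :
    transVal g i i x hi hi = 1 := by
  have h := hg i i i x hi hi hi
  exact (mul_eq_left₀ (transVal_ne_zero g i i x hi hi)).1 h.symm

/-- Holomorphic frames of `L` over the members of `𝒰` with transition functions `g`. -/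
structure Framing (L : LineBundle E X) (𝒰 : PointCover X) (g : Trans E 𝒰) where
  frame : ∀ i, L.sec (𝒰.toFun i)
  ne_zero : ∀ i x, (frame i).1 x ≠ 0
  frame_eq : ∀ i j x (hi : x ∈ 𝒰.toFun i) (hj : x ∈ 𝒰.toFun j),
    (frame j).1 ⟨x, hj⟩ = transVal g i j x hi hj • (frame i).1 ⟨x, hi⟩

namespace Framing

variable {g h : Trans E 𝒰}

theorem isCocycle (S : Framing L 𝒰 g) : IsCocycle g := fun i j k x hi hj hk => by
  apply LineBundle.smul_right_inj_of_ne (S.ne_zero i ⟨x, hi⟩)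
  rw [← S.frame_eq, mul_comm, mul_smul, ← S.frame_eq, ← S.frame_eq]

/-- Restriction of frames to a finer covering. -/
def res (hU : 𝒰 ≤ 𝒱) (S : Framing L 𝒰 g) : Framing L 𝒱 (transRes hU g) where
  frame i := HolSec.res (hU i) (S.frame i)
  ne_zero i x := S.ne_zero i ⟨x, hU i x.2⟩
  frame_eq i j x hi hj := S.frame_eq i j x (hU i hi) (hU j hj)

theorem _root_.HolLine.LineBundle.Iso.map_ne_zero (φ : LineBundle.Iso L M) {U : Opens X}
    {s : L.sec U} (hs : ∀ x, s.1 x ≠ 0) (x : U) : (φ.map s).1 x ≠ 0 :=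
  (φ.equiv x).map_ne_zero_iff.2 (hs x)

/-- Transport of frames along an isomorphism. -/
def map (φ : LineBundle.Iso L M) (S : Framing L 𝒰 g) : Framing M 𝒰 g where
  frame i := φ.map (S.frame i)
  ne_zero i x := φ.map_ne_zero (S.ne_zero i) x
  frame_eq i j x hi hj := by
    change φ.equiv x _ = _ • φ.equiv x _
    rw [S.frame_eq i j x hi hj, map_smul]

/-- The frames given by arbitrary nowhere vanishing local sections. -/
def ofSections (e : ∀ i, L.sec (𝒰.toFun i)) (he : ∀ i x, (e i).1 x ≠ 0) :
    Framing L 𝒰 fun i j => Additive.ofMul (unitOfNeZero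
      ⟨fun x => LineBundle.ratio ((e i).1 ⟨x, x.2.1⟩) ((e j).1 ⟨x, x.2.2⟩),
        LineBundle.ratio_mem (HolSec.res inf_le_left (e i)) (HolSec.res inf_le_right (e j))
          fun x => he i ⟨x, x.2.1⟩⟩ fun x h0 => he j ⟨x, x.2.2⟩ (by
            rw [← LineBundle.ratio_smul (he i ⟨x, x.2.1⟩) ((e j).1 ⟨x, x.2.2⟩)]
            exact (congrArg (· • _) h0).trans (zero_smul ℂ _))) where
  frame := e
  ne_zero := he
  frame_eq i _ x hi _ := (LineBundle.ratio_smul (he i ⟨x, hi⟩) _).symm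

theorem _root_.HolLine.LineBundle.exists_framing (L : LineBundle E X) :
    ∃ (𝒰 : PointCover X) (g : Trans E 𝒰), Nonempty (Framing L 𝒰 g) := by
  choose U hU e he using L.exists_frame
  exact ⟨⟨U, hU⟩, _, ⟨ofSections (𝒰 := ⟨U, hU⟩) e he⟩⟩

/-- The factor g_ij by which the frame of M changes cancels its inverse from the coefficient in L.
The map e_i ↦ f_i is therefore independent of i, so at each x the index x itself may be used. -/
theorem ratio_smul_eq (S : Framing L 𝒰 g) (T : Framing M 𝒰 g) (i j x : X) (hi : x ∈ 𝒰.toFun i)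
    (hj : x ∈ 𝒰.toFun j) (a : L.fiber x) :
    LineBundle.ratio ((S.frame j).1 ⟨x, hj⟩) a • (T.frame j).1 ⟨x, hj⟩ =
      LineBundle.ratio ((S.frame i).1 ⟨x, hi⟩) a • (T.frame i).1 ⟨x, hi⟩ := by
  have hg := transVal_ne_zero g i j x hi hj
  rw [S.frame_eq i j x hi hj, T.frame_eq i j x hi hj,
    LineBundle.ratio_smul_left (S.ne_zero i ⟨x, hi⟩) hg, smul_smul]
  congr 1
  field_simp

theorem coeff_eq_mul (S : Framing L 𝒰 g) {W : Opens X} (s : L.sec W) (i j x : X) (hW : x ∈ W)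
    (hi : x ∈ 𝒰.toFun i) (hj : x ∈ 𝒰.toFun j) :
    LineBundle.ratio ((S.frame i).1 ⟨x, hi⟩) (s.1 ⟨x, hW⟩) =
      LineBundle.ratio ((S.frame j).1 ⟨x, hj⟩) (s.1 ⟨x, hW⟩) * transVal g i j x hi hj := by
  have hg := transVal_ne_zero g i j x hi hj
  rw [S.frame_eq i j x hi hj, LineBundle.ratio_smul_left (S.ne_zero i ⟨x, hi⟩) hg]
  field_simp

/-- The index varies with the point here; by `ratio_smul_eq` it can be frozen near each point, where
the formula is a holomorphic function times a frame. -/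
theorem ratio_smul_mem (S : Framing L 𝒰 g) (T : Framing M 𝒰 g) (U : Opens X) (s : L.sec U) :
    (fun x : U => LineBundle.ratio ((S.frame x).1 ⟨x, 𝒰.mem x⟩) (s.1 x) •
      (T.frame x).1 ⟨x, 𝒰.mem x⟩) ∈ holSec E ℂ M.fiber U := by
  refine mem_holSec_of_local fun x hx => ⟨U ⊓ 𝒰.toFun x, ⟨hx, 𝒰.mem x⟩,
    LineBundle.coeff (S.frame x) (S.ne_zero x) s • HolSec.res inf_le_right (T.frame x),
    fun y hU hW => ?_⟩
  exact S.ratio_smul_eq T y x y (𝒰.mem y) hW.2 (s.1 ⟨y, hU⟩)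

/-- Line bundles with the same transition functions are isomorphic. -/
def iso (S : Framing L 𝒰 g) (T : Framing M 𝒰 g) : LineBundle.Iso L M where
  equiv x := LineBundle.fiberEquiv (S.ne_zero x ⟨x, 𝒰.mem x⟩) (T.ne_zero x ⟨x, 𝒰.mem x⟩)
  map_mem := S.ratio_smul_mem T
  symm_mem := T.ratio_smul_mem S

theorem iso_equiv_apply (S : Framing L 𝒰 g) (T : Framing M 𝒰 g) (i x : X) (hi : x ∈ 𝒰.toFun i)
    (a : L.fiber x) : (S.iso T).equiv x a =
      LineBundle.ratio ((S.frame i).1 ⟨x, hi⟩) a • (T.frame i).1 ⟨x, hi⟩ :=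
  S.ratio_smul_eq T i x x hi (𝒰.mem x) a

/-- The transition factor g_ij h_ij of the target cancels the inverse factors of the two
coefficients, so the pairing of fibres is independent of the index. -/
theorem pair_eq (S : Framing L 𝒰 g) (T : Framing M 𝒰 h) (R : Framing N 𝒰 (g + h)) (i j x : X)
    (hi : x ∈ 𝒰.toFun i) (hj : x ∈ 𝒰.toFun j) (a : L.fiber x) (b : M.fiber x) :
    LineBundle.fiberPair ((S.frame j).1 ⟨x, hj⟩) ((T.frame j).1 ⟨x, hj⟩)
        ((R.frame j).1 ⟨x, hj⟩) a b =
      LineBundle.fiberPair ((S.frame i).1 ⟨x, hi⟩) ((T.frame i).1 ⟨x, hi⟩)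
        ((R.frame i).1 ⟨x, hi⟩) a b := by
  have hg := transVal_ne_zero g i j x hi hj
  have hh := transVal_ne_zero h i j x hi hj
  rw [S.frame_eq i j x hi hj, T.frame_eq i j x hi hj, R.frame_eq i j x hi hj, transVal_add,
    LineBundle.fiberPair_apply, LineBundle.fiberPair_apply,
    LineBundle.ratio_smul_left (S.ne_zero i ⟨x, hi⟩) hg,
    LineBundle.ratio_smul_left (T.ne_zero i ⟨x, hi⟩) hh, smul_smul]
  congr 1
  field_simp

/-- A line bundle whose transition functions are the products of those of `L` and `M` is a tensor
product of `L` and `M`. -/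
def tensor (S : Framing L 𝒰 g) (T : Framing M 𝒰 h) (R : Framing N 𝒰 (g + h)) :
    LineBundle.TensorProduct L M N where
  pair x := LineBundle.fiberPair ((S.frame x).1 ⟨x, 𝒰.mem x⟩) ((T.frame x).1 ⟨x, 𝒰.mem x⟩)
    ((R.frame x).1 ⟨x, 𝒰.mem x⟩)
  isTensorProduct x := LineBundle.isTensorProduct_fiberPair (S.ne_zero x _) (T.ne_zero x _)
    (R.ne_zero x _)
  pair_mem U s t := by
    refine mem_holSec_of_local fun x hx => ⟨U ⊓ 𝒰.toFun x, ⟨hx, 𝒰.mem x⟩,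
      (LineBundle.coeff (S.frame x) (S.ne_zero x) s *
        LineBundle.coeff (T.frame x) (T.ne_zero x) t) • HolSec.res inf_le_right (R.frame x),
      fun y hU hW => ?_⟩
    exact S.pair_eq T R y x y (𝒰.mem y) hW.2 (s.1 ⟨y, hU⟩) (t.1 ⟨y, hU⟩)

theorem tensor_pair_apply (S : Framing L 𝒰 g) (T : Framing M 𝒰 h) (R : Framing N 𝒰 (g + h))
    (i x : X) (hi : x ∈ 𝒰.toFun i) (a : L.fiber x) (b : M.fiber x) :
    (S.tensor T R).pair x a b =
      (LineBundle.ratio ((S.frame i).1 ⟨x, hi⟩) a * LineBundle.ratio ((T.frame i).1 ⟨x, hi⟩) b) •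
        (R.frame i).1 ⟨x, hi⟩ :=
  S.pair_eq T R i x x hi (𝒰.mem x) a b

/-- The frames `e i ⊗ f i` of a tensor product. -/
def tmul (τ : LineBundle.TensorProduct L M N) (S : Framing L 𝒰 g) (T : Framing M 𝒰 h) :
    Framing N 𝒰 (g + h) where
  frame i := τ.tmul (S.frame i) (T.frame i)
  ne_zero i x := LineBundle.pair_ne_zero (τ.isTensorProduct x) (S.ne_zero i x) (T.ne_zero i x)
  frame_eq i j x hi hj := by
    change τ.pair x _ _ = _ • τ.pair x _ _
    rw [S.frame_eq i j x hi hj, T.frame_eq i j x hi hj, transVal_add, map_smul, map_smul,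
      LinearMap.smul_apply, smul_smul, mul_comm]

/-- Holomorphic functions as sections of the trivial line bundle. -/
def _root_.HolLine.funToTrivial {U : Opens X} (f : holFun E U) : (LineBundle.trivial E X).sec U :=
  ⟨f.1, mem_holSec_of_contMDiffAt fun x hx => by
    obtain ⟨t, ht, e⟩ := holFun.exists_contMDiffAt f
    refine ⟨t, ?_, Filter.Eventually.of_forall e⟩
    exact (Bundle.contMDiffAt_section (F := ℂ) (E := Bundle.Trivial X ℂ) x).2 (ht x hx)⟩

variable (𝒰) in
/-- The constant frame `1` of the trivial line bundle. -/
def one : Framing (LineBundle.trivial E X) 𝒰 0 where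
  frame _ := funToTrivial 1
  ne_zero _ _ := one_ne_zero (α := ℂ)
  frame_eq i j x hi hj := by
    rw [transVal_zero]
    exact (one_smul ℂ _).symm

end Framing

end Framings

/-! ### The line bundle of a cocycle. -/

section Construction

variable {E : Type*} [NormedAddCommGroup E] [NormedSpace ℂ E]
  {X : Type*} [TopologicalSpace X] [ChartedSpace E X] [IsManifold 𝓘(ℂ, E) ω X]
  {𝒰 : PointCover X} {g : Trans E 𝒰}

/-- The vector bundle core with transition functions `g`. -/
def IsCocycle.core (hg : IsCocycle g) : VectorBundleCore ℂ X ℂ X where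
  baseSet i := 𝒰.toFun i
  isOpen_baseSet i := (𝒰.toFun i).2
  indexAt x := x
  mem_baseSet_at := 𝒰.mem
  -- From a_i e_i = a_j e_j and e_i = g_ji e_j one gets a_j = g_ji a_i, hence the reversed indices.
  -- The value 0 off the overlap is immaterial.
  coordChange i j x := extendZero (g j i).toMul.val.1 x • ContinuousLinearMap.id ℂ ℂ
  coordChange_self i x hx v := by
    have : extendZero (g i i).toMul.val.1 x = 1 :=
      (extendZero_apply (g i i).toMul.val.1 ⟨x, hx, hx⟩).trans (hg.self i x hx)
    rw [this]
    simp
  continuousOn_coordChange i j := by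
    have h := (contMDiffOn_extendZero (E := E) (g j i).toMul.val).continuousOn
    rw [Set.inter_comm]
    exact h.smul continuousOn_const
  coordChange_comp i j k x hx v := by
    have e (a b : X) (ha : x ∈ 𝒰.toFun a) (hb : x ∈ 𝒰.toFun b) :
        extendZero (g a b).toMul.val.1 x = transVal g a b x ha hb :=
      extendZero_apply (g a b).toMul.val.1 ⟨x, ha, hb⟩
    rw [e j i hx.1.2 hx.1.1, e k j hx.2 hx.1.2, e k i hx.2 hx.1.1,
      hg k j i x hx.2 hx.1.2 hx.1.1]
    simp [mul_assoc]

theorem IsCocycle.core_coordChange (hg : IsCocycle g) (i j x : X) (hi : x ∈ 𝒰.toFun i)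
    (hj : x ∈ 𝒰.toFun j) (v : ℂ) : hg.core.coordChange i j x v = transVal g j i x hj hi * v := by
  change extendZero (g j i).toMul.val.1 x * v = _
  rw [extendZero_apply (g j i).toMul.val.1 ⟨x, hj, hi⟩]
  rfl

instance IsCocycle.core_isContMDiff (hg : IsCocycle g) : hg.core.IsContMDiff 𝓘(ℂ, E) ω where
  contMDiffOn_coordChange i j := by
    have h := contMDiffOn_extendZero (E := E) (g j i).toMul.val
    change ContMDiffOn _ _ _ _ ((𝒰.toFun i : Set X) ∩ 𝒰.toFun j)
    rw [Set.inter_comm]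
    exact h.smul contMDiffOn_const

/-- The line bundle with transition functions `g`. -/
def IsCocycle.lineBundle (hg : IsCocycle g) : LineBundle E X where
  fiber := hg.core.Fiber
  isTopologicalAddGroup _ := inferInstanceAs (IsTopologicalAddGroup ℂ)
  continuousSMul _ := inferInstanceAs (ContinuousSMul ℂ ℂ)

/-- The tautological frames of the line bundle with transition functions `g`. -/
def IsCocycle.framing (hg : IsCocycle g) : Framing hg.lineBundle 𝒰 g where
  frame i := ⟨fun x => hg.core.coordChange i x x 1, fun x => hg.core.coordChange i x x 1, by
    intro x hx
    refine ContMDiffAt.contMDiffWithinAt ?_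
    have hx' : x ∈ (hg.core.localTriv i).baseSet := hx
    have : MemTrivializationAtlas (hg.core.localTriv i) := ⟨⟨i, rfl⟩⟩
    have key := ((hg.core.localTriv i).contMDiffAt_section_iff (IB := 𝓘(ℂ, E)) (n := ω)
      (E := hg.core.Fiber) (s := fun x => hg.core.coordChange i x x 1) hx').2
    refine key ?_
    refine (contMDiffAt_const (c := (1 : ℂ))).congr_of_eventuallyEq ?_
    filter_upwards [(𝒰.toFun i).2.mem_nhds hx] with y hy
    -- The fibre at y is written in the coordinate of index y, so the trivialization of index i
    -- undoes the change of coordinates that defines the frame.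
    change hg.core.coordChange y i y (hg.core.coordChange i y y 1) = 1
    rw [hg.core.coordChange_comp i y i y ⟨⟨hy, 𝒰.mem y⟩, hy⟩, hg.core.coordChange_self i y hy],
    fun _ => rfl⟩
  ne_zero i x := by
    change hg.core.coordChange i x x 1 ≠ 0
    rw [hg.core_coordChange i x x x.2 (𝒰.mem x), mul_one]
    exact transVal_ne_zero _ _ _ _ _ _
  frame_eq i j x hi hj := by
    change hg.core.coordChange j x x 1 = (transVal g i j x hi hj * hg.core.coordChange i x x 1 : ℂ)
    rw [hg.core_coordChange j x x hj (𝒰.mem x), hg.core_coordChange i x x hi (𝒰.mem x),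
      hg x i j x (𝒰.mem x) hi hj]
    ring

end Construction

/-! ### Connection forms, and connections built from them. -/

section Connections

variable {E : Type*} [NormedAddCommGroup E] [NormedSpace ℂ E]
  {X : Type*} [TopologicalSpace X] [ChartedSpace E X] [IsManifold 𝓘(ℂ, E) ω X]
  {L : LineBundle E X}

theorem dlog_apply {U : Opens X} (g : Additive (holFun E U)ˣ) (x : U)
    (v : TangentSpace 𝓘(ℂ, E) (x : X)) :
    ((dlog U g).1 x v : ℂ) = (g.toMul.val.1 x)⁻¹ * (dForm g.toMul.val).1 x v := by
  rw [← unit_inv_apply]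
  rfl

theorem dForm_res_apply {U W : Opens X} (h : W ≤ U) (f : holFun E U) (x : X) (hx : x ∈ W)
    (v : TangentSpace 𝓘(ℂ, E) x) :
    (dForm (holFun.res h f)).1 ⟨x, hx⟩ v = (dForm f).1 ⟨x, h hx⟩ v := by
  rw [dForm_res]
  rfl

theorem dForm_mul_apply {U : Opens X} (f g : holFun E U) (x : U)
    (v : TangentSpace 𝓘(ℂ, E) (x : X)) :
    ((dForm (f * g)).1 x v : ℂ) = f.1 x * (dForm g).1 x v + g.1 x * (dForm f).1 x v := by
  rw [dForm_mul]
  rfl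

theorem dForm_add_apply {U : Opens X} (f g : holFun E U) (x : U)
    (v : TangentSpace 𝓘(ℂ, E) (x : X)) :
    ((dForm (f + g)).1 x v : ℂ) = (dForm f).1 x v + (dForm g).1 x v := by
  rw [dForm_add]
  rfl

theorem dForm_one_apply {U : Opens X} (x : U) (v : TangentSpace 𝓘(ℂ, E) (x : X)) :
    ((dForm (1 : holFun E U)).1 x v : ℂ) = 0 := by
  have h : dForm (1 : holFun E U) = 0 := by simpa using dForm_algebraMap (E := E) (U := U) 1
  rw [h]
  rfl

theorem dlog_unitRes {U W : Opens X} (h : W ≤ U) (g : Additive (holFun E U)ˣ) :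
    dlog W (unitRes h g) = HolSec.res h (dlog U g) := by
  ext x v
  refine (dlog_apply _ x v).trans (Eq.trans ?_ (dlog_apply g ⟨x, h x.2⟩ v).symm)
  exact congrArg (_ * ·) (dForm_res_apply h g.toMul.val x x.2 v)

theorem form_ext {U : Opens X} {θ θ' : L.form U}
    (h : ∀ (x : U) (v : TangentSpace 𝓘(ℂ, E) (x : X)), θ.1 x v = θ'.1 x v) : θ = θ' := by
  ext x v
  exact h x v

/-- `η` is the connection form of `∇` with respect to the frame `e`: `∇ e = η ⊗ e`. -/
def IsConnForm (D : Connection L) {U : Opens X} (e : L.sec U) (η : holForm E U) : Prop :=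
  ∀ (x : U) (v : TangentSpace 𝓘(ℂ, E) (x : X)), (D.nabla U e).1 x v = (η.1 x v : ℂ) • e.1 x

theorem isConnForm_formRatio (D : Connection L) {U : Opens X} (e : L.sec U)
    (he : ∀ x, e.1 x ≠ 0) : IsConnForm D e (LineBundle.formRatio e he (D.nabla U e)) :=
  fun x v => (LineBundle.formRatio_apply_smul e he _ x v).symm

theorem IsConnForm.res {D : Connection L} {U W : Opens X} {e : L.sec U} {η : holForm E U}
    (h : IsConnForm D e η) (hW : W ≤ U) :
    IsConnForm D (HolSec.res hW e) (HolSec.res hW η) := fun x v => by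
  rw [D.nabla_res hW]
  exact h ⟨x, hW x.2⟩ v

theorem IsConnForm.smul {D : Connection L} {U : Opens X} {e : L.sec U} {η : holForm E U}
    (h : IsConnForm D e η) (f : holFun E U) (x : U) (v : TangentSpace 𝓘(ℂ, E) (x : X)) :
    (D.nabla U (f • e)).1 x v = ((dForm f).1 x v + f.1 x * η.1 x v : ℂ) • e.1 x := by
  rw [D.leibniz, h, smul_smul, add_comm, ← add_smul]

/-- The connection in terms of a connection form. -/
theorem IsConnForm.nabla_eq {D : Connection L} {U : Opens X} {e : L.sec U} {η : holForm E U}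
    (h : IsConnForm D e η) (he : ∀ x, e.1 x ≠ 0) {W : Opens X} (s : L.sec W) (x : X) (hW : x ∈ W)
    (hU : x ∈ U) (v : TangentSpace 𝓘(ℂ, E) x) :
    (D.nabla W s).1 ⟨x, hW⟩ v =
      ((dForm (LineBundle.coeff e he s)).1 ⟨x, hW, hU⟩ v +
        (LineBundle.coeff e he s).1 ⟨x, hW, hU⟩ * η.1 ⟨x, hU⟩ v : ℂ) • e.1 ⟨x, hU⟩ := by
  have h1 := (h.res (inf_le_right : W ⊓ U ≤ U)).smul (LineBundle.coeff e he s) ⟨x, hW, hU⟩ v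
  rw [LineBundle.coeff_smul, D.nabla_res] at h1
  exact h1

variable (E) in
/-- Čech `0`-cochains of `1`-forms. -/
abbrev FormC0 (𝒰 : PointCover X) : Type _ :=
  𝒰.C0 E (E →L[ℂ] ℂ) (fun x : X => TangentSpace 𝓘(ℂ, E) x →L[ℂ] Bundle.Trivial X ℂ x)

variable (E) in
/-- Čech `1`-cochains of `1`-forms. -/
abbrev FormC1 (𝒰 : PointCover X) : Type _ :=
  𝒰.C1 E (E →L[ℂ] ℂ) (fun x : X => TangentSpace 𝓘(ℂ, E) x →L[ℂ] Bundle.Trivial X ℂ x)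

variable (E) in
/-- The Čech coboundary of `1`-forms. -/
abbrev formDelta (𝒰 : PointCover X) : FormC0 E 𝒰 →+ FormC1 E 𝒰 :=
  𝒰.delta0 E (E →L[ℂ] ℂ) (fun x : X => TangentSpace 𝓘(ℂ, E) x →L[ℂ] Bundle.Trivial X ℂ x)

/-- The cochain `(dg_ij / g_ij)`. -/
def dlogCochain (𝒰 : PointCover X) : Trans E 𝒰 →+ FormC1 E 𝒰 where
  toFun g i j := dlog _ (g i j)
  map_zero' := funext fun _ => funext fun _ => map_zero _
  map_add' _ _ := funext fun _ => funext fun _ => map_add _ _ _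

variable {𝒰 𝒱 : PointCover X} {g h : Trans E 𝒰}

/-- Evaluation of the equation `dlog g = δ η` at a tangent vector. -/
theorem dlogCochain_eq_iff {η : FormC0 E 𝒰} : dlogCochain 𝒰 g = formDelta E 𝒰 η ↔
    ∀ i j x (hi : x ∈ 𝒰.toFun i) (hj : x ∈ 𝒰.toFun j) (v : TangentSpace 𝓘(ℂ, E) x),
      ((dForm (g i j).toMul.val).1 ⟨x, hi, hj⟩ v : ℂ) = transVal g i j x hi hj *
        ((η j).1 ⟨x, hj⟩ v - (η i).1 ⟨x, hi⟩ v : ℂ) := by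
  have key (i j x : X) (hi : x ∈ 𝒰.toFun i) (hj : x ∈ 𝒰.toFun j) (v : TangentSpace 𝓘(ℂ, E) x) :
      ((dForm (g i j).toMul.val).1 ⟨x, hi, hj⟩ v : ℂ) = transVal g i j x hi hj *
        ((η j).1 ⟨x, hj⟩ v - (η i).1 ⟨x, hi⟩ v : ℂ) ↔
      ((dlog _ (g i j)).1 ⟨x, hi, hj⟩ v : ℂ) = ((η j).1 ⟨x, hj⟩ v - (η i).1 ⟨x, hi⟩ v : ℂ) := by
    rw [dlog_apply]
    exact (inv_mul_eq_iff_eq_mul₀ (transVal_ne_zero g i j x hi hj)).symm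
  simp only [key]
  refine ⟨fun H i j x hi hj v => ?_, fun H => ?_⟩
  · exact congrArg (fun c : FormC1 E 𝒰 => ((c i j).1 ⟨x, hi, hj⟩ v : ℂ)) H
  · funext i j
    ext x v
    exact H i j x x.2.1 x.2.2 v

/-- Frames of a line bundle with connection, with transition functions `g` and connection
forms `η`. -/
structure ConnFraming (P : ConnLineBundle E X) (𝒰 : PointCover X) (g : Trans E 𝒰)
    (η : FormC0 E 𝒰) extends Framing P.bundle 𝒰 g where
  isConnForm : ∀ i, IsConnForm P.conn (frame i) (η i)

namespace Framing

/-- The value at `x` of `∇ s`, computed with the frame of index `i`. -/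
def nablaAt (S : Framing L 𝒰 g) (η : FormC0 E 𝒰) {W : Opens X} (s : L.sec W) (i : X) :
    L.form (W ⊓ 𝒰.toFun i) :=
  LineBundle.formTensor (dForm (LineBundle.coeff (S.frame i) (S.ne_zero i) s) +
      LineBundle.coeff (S.frame i) (S.ne_zero i) s • HolSec.res inf_le_right (η i))
    (HolSec.res inf_le_right (S.frame i))

theorem nablaAt_apply (S : Framing L 𝒰 g) (η : FormC0 E 𝒰) {W : Opens X} (s : L.sec W) (i x : X)
    (hW : x ∈ W) (hi : x ∈ 𝒰.toFun i) (v : TangentSpace 𝓘(ℂ, E) x) :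
    (S.nablaAt η s i).1 ⟨x, hW, hi⟩ v =
      ((dForm (LineBundle.coeff (S.frame i) (S.ne_zero i) s)).1 ⟨x, hW, hi⟩ v +
        (LineBundle.coeff (S.frame i) (S.ne_zero i) s).1 ⟨x, hW, hi⟩ * (η i).1 ⟨x, hi⟩ v : ℂ) •
          (S.frame i).1 ⟨x, hi⟩ := rfl

/-- If s = f e_i = k e_j, then f = k g_ij. The term k dg_ij in df equals k g_ij (η_j - η_i) by
hypothesis, which is exactly what exchanges η_i for η_j. -/
theorem nablaAt_eq (S : Framing L 𝒰 g) {η : FormC0 E 𝒰} (H : dlogCochain 𝒰 g = formDelta E 𝒰 η)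
    {W : Opens X} (s : L.sec W) (i j x : X) (hW : x ∈ W) (hi : x ∈ 𝒰.toFun i)
    (hj : x ∈ 𝒰.toFun j) :
    (S.nablaAt η s i).1 ⟨x, hW, hi⟩ = (S.nablaAt η s j).1 ⟨x, hW, hj⟩ := by
  ext v
  rw [S.nablaAt_apply η s i x hW hi v, S.nablaAt_apply η s j x hW hj v, S.frame_eq i j x hi hj,
    smul_smul]
  congr 1
  set f := LineBundle.coeff (S.frame i) (S.ne_zero i) s
  set k := LineBundle.coeff (S.frame j) (S.ne_zero j) s
  set V : Opens X := W ⊓ (𝒰.toFun i ⊓ 𝒰.toFun j)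
  have hx : x ∈ V := ⟨hW, hi, hj⟩
  have hVi : V ≤ W ⊓ 𝒰.toFun i := inf_le_inf le_rfl inf_le_left
  have hVj : V ≤ W ⊓ 𝒰.toFun j := inf_le_inf le_rfl inf_le_right
  have hVij : V ≤ 𝒰.toFun i ⊓ 𝒰.toFun j := inf_le_right
  -- The three functions are restricted to one open set, so that the product rule applies to f = k
  -- g_ij.
  have e : holFun.res hVi f = holFun.res hVj k * holFun.res hVij (g i j).toMul.val :=
    Subtype.ext (funext fun y => S.coeff_eq_mul s i j y y.2.1 y.2.2.1 y.2.2.2)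
  have h0 : f.1 ⟨x, hW, hi⟩ = k.1 ⟨x, hW, hj⟩ * transVal g i j x hi hj :=
    S.coeff_eq_mul s i j x hW hi hj
  have h1 := dForm_mul_apply (holFun.res hVj k) (holFun.res hVij (g i j).toMul.val) ⟨x, hx⟩ v
  rw [← e, dForm_res_apply hVi f x hx v, dForm_res_apply hVj k x hx v,
    dForm_res_apply hVij _ x hx v, dlogCochain_eq_iff.1 H i j x hi hj v] at h1
  rw [h1, h0]
  change (k.1 ⟨x, hW, hj⟩ * _ + transVal g i j x hi hj * _ + _ : ℂ) = _
  ring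

/-- The connection with given connection forms. -/
def connection (S : Framing L 𝒰 g) {η : FormC0 E 𝒰} (H : dlogCochain 𝒰 g = formDelta E 𝒰 η) :
    Connection L where
  nabla U :=
    -- At x the frame of index x is used; near a given point `nablaAt_eq` replaces it by a fixed
    -- one, which gives holomorphy.
    { toFun := fun s => ⟨fun x => (S.nablaAt η s x).1 ⟨x, x.2, 𝒰.mem x⟩,
        mem_holSec_of_local fun x hx => ⟨U ⊓ 𝒰.toFun x, ⟨hx, 𝒰.mem x⟩, S.nablaAt η s x,
          fun y hU hW => S.nablaAt_eq H s x y y hU hW.2 (𝒰.mem y)⟩⟩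
      map_add' := fun s t => by
        refine form_ext fun x v => ?_
        have e : LineBundle.coeff (S.frame x) (S.ne_zero x) (s + t) =
            LineBundle.coeff (S.frame x) (S.ne_zero x) s +
              LineBundle.coeff (S.frame x) (S.ne_zero x) t :=
          Subtype.ext (funext fun y => map_add (LineBundle.ratio _) _ _)
        change (S.nablaAt η (s + t) x).1 ⟨x, x.2, 𝒰.mem x⟩ v =
          (S.nablaAt η s x).1 ⟨x, x.2, 𝒰.mem x⟩ v + (S.nablaAt η t x).1 ⟨x, x.2, 𝒰.mem x⟩ v
        rw [S.nablaAt_apply η (s + t) x x x.2 (𝒰.mem x) v, S.nablaAt_apply η s x x x.2 (𝒰.mem x) v,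
          S.nablaAt_apply η t x x x.2 (𝒰.mem x) v, ← add_smul, e, dForm_add_apply]
        congr 1
        change _ + ((LineBundle.coeff (S.frame x) (S.ne_zero x) s).1 _ +
          (LineBundle.coeff (S.frame x) (S.ne_zero x) t).1 _) * _ = _
        ring
      map_smul' := fun c s => by
        refine form_ext fun x v => ?_
        have e : LineBundle.coeff (S.frame x) (S.ne_zero x) (c • s) =
            algebraMap ℂ (holFun E _) c * LineBundle.coeff (S.frame x) (S.ne_zero x) s :=
          Subtype.ext (funext fun y => map_smul (LineBundle.ratio _) _ _)
        change (S.nablaAt η (c • s) x).1 ⟨x, x.2, 𝒰.mem x⟩ v =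
          c • (S.nablaAt η s x).1 ⟨x, x.2, 𝒰.mem x⟩ v
        rw [S.nablaAt_apply η (c • s) x x x.2 (𝒰.mem x) v, S.nablaAt_apply η s x x x.2 (𝒰.mem x) v,
          smul_smul, e, dForm_mul_apply, dForm_algebraMap]
        congr 1
        change c * _ + _ * 0 + c * (LineBundle.coeff (S.frame x) (S.ne_zero x) s).1 _ * _ = _
        ring }
  nabla_res := fun {U W} hW s => by
    ext x v
    change (S.nablaAt η (HolSec.res hW s) x).1 ⟨x, x.2, 𝒰.mem x⟩ v =
      (S.nablaAt η s x).1 ⟨x, hW x.2, 𝒰.mem x⟩ v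
    have e : LineBundle.coeff (S.frame x) (S.ne_zero x) (HolSec.res hW s) =
      holFun.res (inf_le_inf hW le_rfl) (LineBundle.coeff (S.frame x) (S.ne_zero x) s) := rfl
    rw [S.nablaAt_apply η _ x x x.2 (𝒰.mem x) v, S.nablaAt_apply η s x x (hW x.2) (𝒰.mem x) v, e,
      dForm_res_apply (inf_le_inf hW le_rfl) _ x.1 ⟨x.2, 𝒰.mem x⟩ v]
    rfl
  leibniz := fun {U} f s x v => by
    change (S.nablaAt η (f • s) x).1 ⟨x, x.2, 𝒰.mem x⟩ v =
      f.1 x • (S.nablaAt η s x).1 ⟨x, x.2, 𝒰.mem x⟩ v + _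
    have e : LineBundle.coeff (S.frame x) (S.ne_zero x) (f • s) =
        holFun.res inf_le_left f * LineBundle.coeff (S.frame x) (S.ne_zero x) s :=
      Subtype.ext (funext fun y => map_smul (LineBundle.ratio _) _ _)
    rw [S.nablaAt_apply η _ x x x.2 (𝒰.mem x) v, S.nablaAt_apply η s x x x.2 (𝒰.mem x) v, e, dForm_mul_apply,
      dForm_res_apply inf_le_left f x.1 ⟨x.2, 𝒰.mem x⟩ v, smul_smul]
    have hs : s.1 x = (LineBundle.coeff (S.frame x) (S.ne_zero x) s).1 ⟨x, x.2, 𝒰.mem x⟩ •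
        (S.frame x).1 ⟨x, 𝒰.mem x⟩ := (LineBundle.ratio_smul (S.ne_zero x ⟨x, 𝒰.mem x⟩) _).symm
    rw [hs, smul_smul, ← add_smul]
    congr 1
    set k := LineBundle.coeff (S.frame x) (S.ne_zero x) s
    change f.1 x * _ + k.1 ⟨x, x.2, 𝒰.mem x⟩ * _ + (f.1 x * k.1 ⟨x, x.2, 𝒰.mem x⟩) * _ =
      f.1 x * _ + _ * k.1 ⟨x, x.2, 𝒰.mem x⟩
    ring

theorem isConnForm_connection (S : Framing L 𝒰 g) {η : FormC0 E 𝒰}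
    (H : dlogCochain 𝒰 g = formDelta E 𝒰 η) (i : X) :
    IsConnForm (S.connection H) (S.frame i) (η i) := fun x v => by
  change (S.nablaAt η (S.frame i) x).1 ⟨x, x.2, 𝒰.mem x⟩ v = _
  rw [S.nablaAt_eq H _ x i x x.2 (𝒰.mem x) x.2, S.nablaAt_apply η _ i x x.2 x.2 v]
  have e : LineBundle.coeff (S.frame i) (S.ne_zero i) (S.frame i) = 1 :=
    Subtype.ext (funext fun y => LineBundle.ratio_self (S.ne_zero i ⟨y, y.2.1⟩))
  rw [e, dForm_one_apply, zero_add]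
  congr 1
  exact one_mul _

/-- A line bundle with frames, equipped with the connection with given connection forms. -/
def connFraming (S : Framing L 𝒰 g) {η : FormC0 E 𝒰} (H : dlogCochain 𝒰 g = formDelta E 𝒰 η) :
    ConnFraming ⟨L, S.connection H⟩ 𝒰 g η where
  toFraming := S
  isConnForm := S.isConnForm_connection H

end Framing

end Connections

/-! ### Čech classes in the direct limit. -/

section Cech

variable {E : Type*} [NormedAddCommGroup E] [NormedSpace ℂ E]
  {X : Type*} [TopologicalSpace X] [ChartedSpace E X]
  {F : Type*} [NormedAddCommGroup F] [NormedSpace ℂ F]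
  {V : X → Type*} [TopologicalSpace (TotalSpace F V)] [∀ x, AddCommGroup (V x)]
  [∀ x, Module ℂ (V x)] [∀ x, TopologicalSpace (V x)] [FiberBundle F V] [VectorBundle ℂ F V]

/-- The common refinement of two coverings. -/
def PointCover.inter (𝒰 𝒱 : PointCover X) : PointCover X :=
  ⟨fun x => 𝒰.toFun x ⊓ 𝒱.toFun x, fun x => ⟨𝒰.mem x, 𝒱.mem x⟩⟩

theorem PointCover.le_inter_left (𝒰 𝒱 : PointCover X) : 𝒰 ≤ 𝒰.inter 𝒱 := fun _ => inf_le_left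

theorem PointCover.le_inter_right (𝒰 𝒱 : PointCover X) : 𝒱 ≤ 𝒰.inter 𝒱 := fun _ => inf_le_right

instance : IsDirectedOrder (PointCover X) :=
  ⟨fun 𝒰 𝒱 => ⟨𝒰.inter 𝒱, 𝒰.le_inter_left 𝒱, 𝒰.le_inter_right 𝒱⟩⟩

variable (E F V) in
instance : DirectedSystem (fun 𝒰 : PointCover X => 𝒰.H1 E F V)
    fun 𝒰 𝒱 h => PointCover.resH1 E F V 𝒰 𝒱 h where
  map_self 𝒰 c := by
    obtain ⟨c, rfl⟩ := QuotientAddGroup.mk_surjective c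
    rfl
  map_map 𝒰 𝒱 𝒲 h h' c := by
    obtain ⟨c, rfl⟩ := QuotientAddGroup.mk_surjective c
    rfl

variable {𝒰 𝒱 : PointCover X}

theorem cechClass_add (c d : 𝒰.Z1 E F V) : cechClass (c + d) = cechClass c + cechClass d := by
  unfold cechClass
  rw [map_add, map_add]
  rfl

theorem cechClass_res (h : 𝒰 ≤ 𝒱) (c : 𝒰.Z1 E F V) :
    cechClass (PointCover.resZ1 E F V h c) = cechClass c := by
  classical
  exact AddCommGroup.DirectLimit.of_f (G := fun 𝒰 : PointCover X => 𝒰.H1 E F V)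
    (f := PointCover.resH1 E F V) h (𝒰.toH1 E F V c)

theorem toH1_eq_zero_iff (c : 𝒰.Z1 E F V) :
    𝒰.toH1 E F V c = 0 ↔ ∃ b, 𝒰.delta0 E F V b = c.1 :=
  (QuotientAddGroup.eq_zero_iff (N := (𝒰.delta0 E F V).range.addSubgroupOf (𝒰.Z1 E F V)) c)

/-- Coverings are directed under refinement, so an element of the limit is zero only if it already
becomes zero in H¹ of some finer covering. -/
theorem cechClass_eq_zero_iff (c : 𝒰.Z1 E F V) :
    cechClass c = 0 ↔
      ∃ (𝒱 : PointCover X) (h : 𝒰 ≤ 𝒱) (b : 𝒱.C0 E F V),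
        𝒱.delta0 E F V b = PointCover.resC1 E F V h c.1 := by
  classical
  constructor
  · intro h
    obtain ⟨𝒱, hV, h'⟩ := AddCommGroup.DirectLimit.of.zero_exact
      (G := fun 𝒰 : PointCover X => 𝒰.H1 E F V) (f := PointCover.resH1 E F V) 𝒰 _ h
    obtain ⟨b, hb⟩ := (toH1_eq_zero_iff (PointCover.resZ1 E F V hV c)).1 h'
    exact ⟨𝒱, hV, b, hb⟩
  · rintro ⟨𝒱, hV, b, hb⟩
    rw [← cechClass_res hV]
    have h := (toH1_eq_zero_iff (PointCover.resZ1 E F V hV c)).2 ⟨b, hb⟩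
    unfold cechClass
    rw [h, map_zero]
    rfl

theorem cechClass_congr {c d : 𝒰.Z1 E F V} (b : 𝒰.C0 E F V) (h : d.1 = c.1 + 𝒰.delta0 E F V b) :
    cechClass d = cechClass c := by
  have hd : d = c + (d - c) := by abel
  have h0 : cechClass (d - c) = 0 := by
    refine (cechClass_eq_zero_iff _).2 ⟨𝒰, le_rfl, b, ?_⟩
    have : (d - c).1 = 𝒰.delta0 E F V b := by
      rw [AddSubgroup.coe_sub, h, add_sub_cancel_left]
    rw [this]
    rfl
  rw [hd, cechClass_add, h0, add_zero]

end Cech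

/-! ### Line bundles with connection in terms of frames and connection forms. -/

section ConnFramings

variable {E : Type*} [NormedAddCommGroup E] [NormedSpace ℂ E]
  {X : Type*} [TopologicalSpace X] [ChartedSpace E X] [IsManifold 𝓘(ℂ, E) ω X]
  {P Q R : ConnLineBundle E X} {𝒰 𝒱 : PointCover X} {g h : Trans E 𝒰} {η θ : FormC0 E 𝒰}

namespace ConnFraming

/-- Compute ∇ e_j twice: as η_j ⊗ e_j, and by the Leibniz rule as (dg_ij + g_ij η_i) ⊗ e_i.
Comparing coefficients of e_i gives g_ij η_j = dg_ij + g_ij η_i. -/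
theorem dlog_eq_delta (S : ConnFraming P 𝒰 g η) : dlogCochain 𝒰 g = formDelta E 𝒰 η := by
  rw [dlogCochain_eq_iff]
  intro i j x hi hj v
  have hx : x ∈ 𝒰.toFun i ⊓ 𝒰.toFun j := ⟨hi, hj⟩
  have e : (g i j).toMul.val • HolSec.res inf_le_left (S.frame i) =
      HolSec.res (inf_le_right : 𝒰.toFun i ⊓ 𝒰.toFun j ≤ _) (S.frame j) :=
    HolSec.ext fun y => (S.frame_eq i j y y.2.1 y.2.2).symm
  have h1 := ((S.isConnForm i).res (inf_le_left : 𝒰.toFun i ⊓ 𝒰.toFun j ≤ _)).smul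
    (g i j).toMul.val ⟨x, hx⟩ v
  have h2 := (S.isConnForm j).res (inf_le_right : 𝒰.toFun i ⊓ 𝒰.toFun j ≤ _) ⟨x, hx⟩ v
  rw [e, h2] at h1
  change ((η j).1 ⟨x, hj⟩ v : ℂ) • (S.frame j).1 ⟨x, hj⟩ =
    ((dForm (g i j).toMul.val).1 ⟨x, hi, hj⟩ v + transVal g i j x hi hj * (η i).1 ⟨x, hi⟩ v : ℂ) •
      (S.frame i).1 ⟨x, hi⟩ at h1
  rw [S.frame_eq i j x hi hj, smul_smul] at h1
  have h3 := LineBundle.smul_right_inj_of_ne (S.ne_zero i ⟨x, hi⟩) h1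
  linear_combination -h3

/-- Restriction to a finer covering. -/
def res (hU : 𝒰 ≤ 𝒱) (S : ConnFraming P 𝒰 g η) :
    ConnFraming P 𝒱 (transRes hU g) fun i => HolSec.res (hU i) (η i) where
  toFraming := S.toFraming.res hU
  isConnForm i := (S.isConnForm i).res (hU i)

/-- Transport along an isomorphism. -/
def map (φ : ConnLineBundle.Iso P Q) (S : ConnFraming P 𝒰 g η) : ConnFraming Q 𝒰 g η where
  toFraming := S.toFraming.map φ.toIso
  isConnForm i x v := by
    refine (φ.comm _ (S.frame i) x v).trans ?_
    rw [S.isConnForm i x v, map_smul]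
    rfl

/-- Every line bundle with connection has connection forms with respect to given frames. -/
def ofFraming (P : ConnLineBundle E X) (S : Framing P.bundle 𝒰 g) :
    ConnFraming P 𝒰 g fun i =>
      LineBundle.formRatio (S.frame i) (S.ne_zero i) (P.conn.nabla _ (S.frame i)) where
  toFraming := S
  isConnForm i := isConnForm_formRatio P.conn (S.frame i) (S.ne_zero i)

/-- Line bundles with connection with the same transition functions and connection forms are
isomorphic. -/
def iso (S : ConnFraming P 𝒰 g η) (T : ConnFraming Q 𝒰 g η) : ConnLineBundle.Iso P Q where
  toIso := S.toFraming.iso T.toFraming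
  comm U s x v := by
    have hx := 𝒰.mem x
    -- The isomorphism carries frames to frames, hence preserves coefficients; both connections are
    -- then given by the same formula in them.
    have e : LineBundle.coeff (T.frame x) (T.ne_zero x) ((S.toFraming.iso T.toFraming).map s) =
        LineBundle.coeff (S.frame x) (S.ne_zero x) s := by
      refine Subtype.ext (funext fun y => ?_)
      refine (congrArg (LineBundle.ratio _)
        (S.toFraming.iso_equiv_apply T.toFraming x y y.2.2 (s.1 ⟨y, y.2.1⟩))).trans ?_
      exact LineBundle.ratio_smul_self (T.ne_zero x ⟨y, y.2.2⟩) _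
    have h1 := (T.isConnForm x).nabla_eq (T.ne_zero x)
      ((S.toFraming.iso T.toFraming).map s) x x.2 hx v
    have h2 := (S.isConnForm x).nabla_eq (S.ne_zero x) s x x.2 hx v
    rw [e] at h1
    refine h1.trans (Eq.trans ?_ (congrArg ((S.toFraming.iso T.toFraming).equiv x) h2).symm)
    rw [map_smul, S.toFraming.iso_equiv_apply T.toFraming x x hx,
      LineBundle.ratio_self (S.ne_zero x ⟨x, hx⟩), one_smul]

/-- A line bundle with connection whose transition functions are the products and whose connection
forms are the sums of those of `P` and `Q` is a tensor product of `P` and `Q`. -/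
def tensor (S : ConnFraming P 𝒰 g η) (T : ConnFraming Q 𝒰 h θ)
    (Z : ConnFraming R 𝒰 (g + h) (η + θ)) : ConnLineBundle.TensorProduct P Q R where
  toTensorProduct := S.toFraming.tensor T.toFraming Z.toFraming
  nabla_tmul U s t x v := by
    have hx := 𝒰.mem x
    set τ := S.toFraming.tensor T.toFraming Z.toFraming
    set a := LineBundle.coeff (S.frame x) (S.ne_zero x) s with ha
    set b := LineBundle.coeff (T.frame x) (T.ne_zero x) t with hb
    -- The coefficient of s ⊗ t is the product ab, so the required identity is the product rule for
    -- d(ab) together with the added connection forms.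
    have e : LineBundle.coeff (Z.frame x) (Z.ne_zero x) (τ.tmul s t) = a * b := by
      refine Subtype.ext (funext fun y => ?_)
      refine (congrArg (LineBundle.ratio _) (S.toFraming.tensor_pair_apply T.toFraming Z.toFraming
        x y y.2.2 (s.1 ⟨y, y.2.1⟩) (t.1 ⟨y, y.2.1⟩))).trans ?_
      exact LineBundle.ratio_smul_self (Z.ne_zero x ⟨y, y.2.2⟩) _
    have h1 := (S.isConnForm x).nabla_eq (S.ne_zero x) s x x.2 hx v
    have h2 := (T.isConnForm x).nabla_eq (T.ne_zero x) t x x.2 hx v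
    have h3 := (Z.isConnForm x).nabla_eq (Z.ne_zero x) (τ.tmul s t) x x.2 hx v
    rw [e] at h3
    refine h3.trans (Eq.trans ?_ (congrArg₂ (fun c d => τ.pair x c (t.1 x) + τ.pair x (s.1 x) d)
      h1 h2).symm)
    have p := S.toFraming.tensor_pair_apply T.toFraming Z.toFraming x x hx
    simp only [τ, p]
    rw [LineBundle.ratio_smul_self (S.ne_zero x ⟨x, hx⟩),
      LineBundle.ratio_smul_self (T.ne_zero x ⟨x, hx⟩), ← add_smul, dForm_mul_apply]
    congr 1
    change _ + (a.1 ⟨x, x.2, hx⟩ * b.1 ⟨x, x.2, hx⟩) *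
        ((η x).1 ⟨x, hx⟩ v + (θ x).1 ⟨x, hx⟩ v : ℂ) =
      (_ + a.1 ⟨x, x.2, hx⟩ * (η x).1 ⟨x, hx⟩ v : ℂ) * b.1 ⟨x, x.2, hx⟩ +
        a.1 ⟨x, x.2, hx⟩ * (_ + b.1 ⟨x, x.2, hx⟩ * (θ x).1 ⟨x, hx⟩ v : ℂ)
    ring

/-- The frames `e i ⊗ f i` of a tensor product of line bundles with connection. -/
def tmul (τ : ConnLineBundle.TensorProduct P Q R) (S : ConnFraming P 𝒰 g η)
    (T : ConnFraming Q 𝒰 h θ) : ConnFraming R 𝒰 (g + h) (η + θ) where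
  toFraming := S.toFraming.tmul τ.toTensorProduct T.toFraming
  isConnForm i x v := by
    refine (τ.nabla_tmul _ (S.frame i) (T.frame i) x v).trans ?_
    rw [S.isConnForm i x v, T.isConnForm i x v, map_smul, map_smul, LinearMap.smul_apply,
      ← add_smul]
    rfl

variable (𝒰) in
/-- The constant frame `1` of the trivial line bundle with the connection `d + η`. -/
def one (ζ : holForm E (⊤ : Opens X)) :
    ConnFraming ⟨LineBundle.trivial E X, trivialConn ζ⟩ 𝒰 0 fun _ => HolSec.res le_top ζ where
  toFraming := Framing.one 𝒰
  isConnForm i x v := by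
    change ((dForm (1 : holFun E (𝒰.toFun i))).1 x v + 1 * ζ.1 ⟨x, trivial⟩ v : ℂ) =
      (ζ.1 ⟨x, trivial⟩ v : ℂ) * 1
    rw [dForm_one_apply]
    ring

end ConnFraming

end ConnFramings

/-! ### Group structure on isomorphism classes from representatives. -/

section TensorGroup

/-- A set with a relation `T a b c` ("`c` is a product of `a` and `b`") whose elements have
representatives by elements of abelian groups `K i`, compatible with `T`, has an abelian group as
its quotient by isomorphism. -/
theorem exists_addCommGroup_quotient {α : Type*} [s : Setoid α] (T : α → α → α → Prop)
    {I : Type*} [Preorder I] [IsDirectedOrder I] (K : I → Type*) [∀ i, AddCommGroup (K i)]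
    (Has : ∀ i, α → K i → Prop) (one : α)
    (hex : ∀ a, ∃ i k, Has i a k)
    (hres : ∀ i j, i ≤ j → ∀ a k, Has i a k → ∃ k', Has j a k')
    (hiso : ∀ i a b k, Has i a k → Has i b k → a ≈ b)
    (hmap : ∀ i a b k, a ≈ b → Has i a k → Has i b k)
    (htmul : ∀ i a b c k l, T a b c → Has i a k → Has i b l → Has i c (k + l))
    (htensor : ∀ i a b c k l, Has i a k → Has i b l → Has i c (k + l) → T a b c)
    (hone : ∀ i, Has i one 0)
    (hadd : ∀ i a b k l, Has i a k → Has i b l → ∃ c, Has i c (k + l))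
    (hneg : ∀ i a k, Has i a k → ∃ c, Has i c (-k)) :
    (∀ a b, ∃ c, T a b c) ∧ ∃ _ : AddCommGroup (Quotient s),
      (⟦one⟧ : Quotient s) = 0 ∧ ∀ a b c, T a b c → (⟦c⟧ : Quotient s) = ⟦a⟧ + ⟦b⟧ := by
  -- Directedness puts representatives of several elements into a single group K i.
  have two (a b : α) : ∃ i k l, Has i a k ∧ Has i b l := by
    obtain ⟨i, k, hk⟩ := hex a
    obtain ⟨j, l, hl⟩ := hex b
    obtain ⟨m, hi, hj⟩ := exists_ge_ge i j
    obtain ⟨k', hk'⟩ := hres i m hi a k hk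
    obtain ⟨l', hl'⟩ := hres j m hj b l hl
    exact ⟨m, k', l', hk', hl'⟩
  have three (a b c : α) : ∃ i k l n, Has i a k ∧ Has i b l ∧ Has i c n := by
    obtain ⟨i, k, l, hk, hl⟩ := two a b
    obtain ⟨j, n, hn⟩ := hex c
    obtain ⟨m, hi, hj⟩ := exists_ge_ge i j
    obtain ⟨k', hk'⟩ := hres i m hi a k hk
    obtain ⟨l', hl'⟩ := hres i m hi b l hl
    obtain ⟨n', hn'⟩ := hres j m hj c n hn
    exact ⟨m, k', l', n', hk', hl', hn'⟩
  have ex (a b : α) : ∃ c, T a b c := by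
    obtain ⟨i, k, l, hk, hl⟩ := two a b
    obtain ⟨c, hc⟩ := hadd i a b k l hk hl
    exact ⟨c, htensor i a b c k l hk hl hc⟩
  -- Both products are represented by the same element k + l, so they are isomorphic: the product is
  -- well defined on classes.
  have uniq (a a' b b' c c' : α) (ha : a ≈ a') (hb : b ≈ b') (hc : T a b c) (hc' : T a' b' c') :
      c ≈ c' := by
    obtain ⟨i, k, l, hk, hl⟩ := two a b
    exact hiso i c c' _ (htmul i a b c k l hc hk hl)
      (htmul i a' b' c' k l hc' (hmap i a a' k ha hk) (hmap i b b' l hb hl))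
  choose m hm using ex
  refine ⟨fun a b => ⟨m a b, hm a b⟩, ?_⟩
  let add : Quotient s → Quotient s → Quotient s :=
    Quotient.map₂ m fun a a' ha b b' hb => uniq a a' b b' _ _ ha hb (hm a b) (hm a' b')
  have add_mk (a b c : α) (hc : T a b c) : (⟦c⟧ : Quotient s) = add ⟦a⟧ ⟦b⟧ :=
    Quotient.sound (uniq a a b b c (m a b) (Setoid.refl a) (Setoid.refl b) hc (hm a b))
  have neg_ex (q : Quotient s) : ∃ r, add r q = ⟦one⟧ := by
    induction q using Quotient.inductionOn with | _ a
    obtain ⟨i, k, hk⟩ := hex a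
    obtain ⟨c, hc⟩ := hneg i a k hk
    refine ⟨⟦c⟧, (add_mk c a one (htensor i c a one _ _ hc hk ?_)).symm⟩
    rw [neg_add_cancel]
    exact hone i
  choose neg hneg' using neg_ex
  let _ : Add (Quotient s) := ⟨add⟩
  let _ : Zero (Quotient s) := ⟨⟦one⟧⟩
  let _ : Neg (Quotient s) := ⟨neg⟩
  -- Each axiom holds for representatives in some K i and passes to classes by `hiso`.
  let G : AddGroup (Quotient s) := AddGroup.ofLeftAxioms
    (by
      intro p q r
      induction p using Quotient.inductionOn with | _ a
      induction q using Quotient.inductionOn with | _ b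
      induction r using Quotient.inductionOn with | _ c
      obtain ⟨i, k, l, n, hk, hl, hn⟩ := three a b c
      refine Quotient.sound (hiso i _ _ (k + l + n) ?_ ?_)
      · exact htmul i _ _ _ _ _ (hm _ _) (htmul i _ _ _ _ _ (hm _ _) hk hl) hn
      · rw [add_assoc]
        exact htmul i _ _ _ _ _ (hm _ _) hk (htmul i _ _ _ _ _ (hm _ _) hl hn))
    (by
      intro q
      induction q using Quotient.inductionOn with | _ a
      obtain ⟨i, k, hk⟩ := hex a
      refine Quotient.sound (hiso i _ _ k ?_ hk)
      have := htmul i _ _ _ _ _ (hm one a) (hone i) hk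
      rwa [zero_add] at this)
    hneg'
  refine ⟨{ G with add_comm := ?_ }, rfl, add_mk⟩
  intro p q
  induction p using Quotient.inductionOn with | _ a
  induction q using Quotient.inductionOn with | _ b
  obtain ⟨i, k, l, hk, hl⟩ := two a b
  refine Quotient.sound (hiso i _ _ (k + l) (htmul i _ _ _ _ _ (hm a b) hk hl) ?_)
  rw [add_comm]
  exact htmul i _ _ _ _ _ (hm b a) hl hk

end TensorGroup

/-! ### Change of frames. -/

section FramingChange

variable {E : Type*} [NormedAddCommGroup E] [NormedSpace ℂ E]
  {X : Type*} [TopologicalSpace X] [ChartedSpace E X]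
  {L M : LineBundle E X} {𝒰 : PointCover X} {g h : Trans E 𝒰}

namespace Framing

/-- The functions `u i` with `f i = u i • e i` for two families of frames. -/
def change (S : Framing L 𝒰 g) (T : Framing L 𝒰 h) (i : X) : Additive (holFun E (𝒰.toFun i))ˣ :=
  Additive.ofMul (unitOfNeZero
    ⟨fun x => LineBundle.ratio ((S.frame i).1 x) ((T.frame i).1 x),
      LineBundle.ratio_mem (S.frame i) (T.frame i) (S.ne_zero i)⟩ fun x h0 => T.ne_zero i x (by
        rw [← LineBundle.ratio_smul (S.ne_zero i x) ((T.frame i).1 x)]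
        exact (congrArg (· • _) h0).trans (zero_smul ℂ _)))

theorem change_smul (S : Framing L 𝒰 g) (T : Framing L 𝒰 h) (i : X) (x : 𝒰.toFun i) :
    (S.change T i).toMul.val.1 x • (S.frame i).1 x = (T.frame i).1 x :=
  LineBundle.ratio_smul (S.ne_zero i x) _

/-- Both sides are the coefficient of f_j with respect to e_i, reached through f_i on the left and
through e_j on the right. -/
theorem trans_change (S : Framing L 𝒰 g) (T : Framing L 𝒰 h) (i j : X) :
    unitRes inf_le_left (S.change T i) + h i j = g i j + unitRes inf_le_right (S.change T j) := by
  refine congrArg Additive.ofMul (unit_ext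
    (g := (unitRes inf_le_left (S.change T i)).toMul * (h i j).toMul)
    (h := (g i j).toMul * (unitRes inf_le_right (S.change T j)).toMul) fun x => ?_)
  apply LineBundle.smul_right_inj_of_ne (S.ne_zero i ⟨x, x.2.1⟩)
  have h1 := T.frame_eq i j x x.2.1 x.2.2
  rw [← S.change_smul T i, ← S.change_smul T j, S.frame_eq i j x x.2.1 x.2.2, smul_smul,
    smul_smul] at h1
  refine Eq.trans ?_ (h1.symm.trans ?_)
  · exact congrArg (· • _) (mul_comm _ _)
  · exact congrArg (· • _) (mul_comm _ _)

end Framing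

theorem LineBundle.exists_framing_pair (L M : LineBundle E X) :
    ∃ (𝒰 : PointCover X) (g h : Trans E 𝒰), Nonempty (Framing L 𝒰 g) ∧
      Nonempty (Framing M 𝒰 h) := by
  obtain ⟨𝒰, g, ⟨S⟩⟩ := L.exists_framing
  obtain ⟨𝒱, h, ⟨T⟩⟩ := M.exists_framing
  exact ⟨𝒰.inter 𝒱, _, _, ⟨S.res (𝒰.le_inter_left 𝒱)⟩, ⟨T.res (𝒰.le_inter_right 𝒱)⟩⟩

theorem LineBundle.nonempty_localFrames (L : LineBundle E X) : Nonempty (LocalFrames L) := by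
  obtain ⟨𝒰, g, ⟨S⟩⟩ := L.exists_framing
  exact ⟨⟨𝒰, S.frame, S.ne_zero, fun i j => (g i j).toMul,
    fun i j => HolSec.ext fun x => S.frame_eq i j x x.2.1 x.2.2⟩⟩

end FramingChange

variable {E : Type*} [NormedAddCommGroup E] [NormedSpace ℂ E]
  {X : Type*} [TopologicalSpace X] [ChartedSpace E X] [IsManifold 𝓘(ℂ, E) ω X]

/-! ### The class in H¹(X, Ω¹). -/

section AtiyahClass

variable {L M N : LineBundle E X} {𝒰 𝒱 : PointCover X} {g h : Trans E 𝒰}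

/-- The homomorphism dlog commutes with restriction and turns g_ik = g_ij g_jk into the additive
cocycle condition. -/
theorem IsCocycle.dlogCochain_mem (hg : IsCocycle g) : dlogCochain 𝒰 g ∈ Z1Form 𝒰 := by
  intro i j k
  set W := 𝒰.toFun i ⊓ 𝒰.toFun j ⊓ 𝒰.toFun k
  have hjk : W ≤ 𝒰.toFun j ⊓ 𝒰.toFun k := le_inf (inf_le_left.trans inf_le_right) inf_le_right
  have hik : W ≤ 𝒰.toFun i ⊓ 𝒰.toFun k := le_inf (inf_le_left.trans inf_le_left) inf_le_right
  have hij : W ≤ 𝒰.toFun i ⊓ 𝒰.toFun j := inf_le_left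
  have e : unitRes hik (g i k) = unitRes hij (g i j) + unitRes hjk (g j k) :=
    congrArg Additive.ofMul (unit_ext (g := (unitRes hik (g i k)).toMul)
      (h := (unitRes hij (g i j)).toMul * (unitRes hjk (g j k)).toMul)
      fun x => hg i j k x x.2.1.1 x.2.1.2 x.2.2)
  change HolSec.res hjk (dlog _ (g j k)) - HolSec.res hik (dlog _ (g i k)) +
    HolSec.res hij (dlog _ (g i j)) = 0
  rw [← dlog_unitRes, ← dlog_unitRes, ← dlog_unitRes, e, map_add]
  abel

theorem resC1_dlogCochain (hU : 𝒰 ≤ 𝒱) (g : Trans E 𝒰) :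
    PointCover.resC1 E (E →L[ℂ] ℂ)
      (fun x : X => TangentSpace 𝓘(ℂ, E) x →L[ℂ] Bundle.Trivial X ℂ x) hU (dlogCochain 𝒰 g) =
      dlogCochain 𝒱 (transRes hU g) :=
  funext fun i => funext fun j => (dlog_unitRes (inf_le_inf (hU i) (hU j)) (g i j)).symm

namespace Framing

/-- The class of the Čech cocycle `(dg_ij / g_ij)`. -/
def atiyahClass (S : Framing L 𝒰 g) : H1Form E X :=
  cechClass (⟨dlogCochain 𝒰 g, S.isCocycle.dlogCochain_mem⟩ : Z1Form 𝒰)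

theorem atiyahClass_res (hU : 𝒰 ≤ 𝒱) (S : Framing L 𝒰 g) :
    (S.res hU).atiyahClass = S.atiyahClass := by
  refine Eq.trans ?_ (cechClass_res hU _)
  exact congrArg cechClass (Subtype.ext (resC1_dlogCochain hU g).symm)

/-- After passing to a common refinement, two families of frames differ by units u_i, and the
cocycles differ by the coboundary of dlog u. -/
theorem atiyahClass_eq (S : Framing L 𝒰 g) {h : Trans E 𝒱} (T : Framing L 𝒱 h) :
    S.atiyahClass = T.atiyahClass := by
  have same {𝒲 : PointCover X} {k l : Trans E 𝒲} (S : Framing L 𝒲 k) (T : Framing L 𝒲 l) :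
      T.atiyahClass = S.atiyahClass := by
    refine cechClass_congr (fun i => dlog _ (S.change T i)) ?_
    funext i j
    change dlog _ (l i j) = dlog _ (k i j) + (HolSec.res inf_le_right (dlog _ (S.change T j)) -
      HolSec.res inf_le_left (dlog _ (S.change T i)))
    rw [← dlog_unitRes, ← dlog_unitRes, ← map_sub, ← map_add, ← add_sub_assoc,
      ← S.trans_change T i j, add_sub_cancel_left]
  rw [← S.atiyahClass_res (𝒰.le_inter_left 𝒱), ← T.atiyahClass_res (𝒰.le_inter_right 𝒱)]
  exact same _ _

theorem atiyahClass_tmul (τ : LineBundle.TensorProduct L M N) (S : Framing L 𝒰 g)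
    (T : Framing M 𝒰 h) : (S.tmul τ T).atiyahClass = S.atiyahClass + T.atiyahClass :=
  (congrArg cechClass (Subtype.ext (map_add (dlogCochain 𝒰) g h))).trans (cechClass_add _ _)

end Framing

/-- The obstruction in `H¹(X, Ω¹)` to the existence of a holomorphic connection. -/
def LineBundle.atiyahClass (L : LineBundle E X) : H1Form E X :=
  L.exists_framing.choose_spec.choose_spec.some.atiyahClass

theorem Framing.atiyahClass_eq_lineBundle (S : Framing L 𝒰 g) : S.atiyahClass = L.atiyahClass :=
  S.atiyahClass_eq _

theorem LineBundle.atiyahClass_congr (φ : LineBundle.Iso L M) : L.atiyahClass = M.atiyahClass := by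
  obtain ⟨𝒰, g, ⟨S⟩⟩ := L.exists_framing
  rw [← S.atiyahClass_eq_lineBundle, ← (S.map φ).atiyahClass_eq_lineBundle]
  rfl

/-- The map `Pic(X) → H¹(X, Ω¹)`. -/
def atiyahMap : PicAn E X → H1Form E X :=
  Quotient.lift LineBundle.atiyahClass fun _ _ ⟨φ⟩ => LineBundle.atiyahClass_congr φ

theorem LineBundle.atiyahClass_tensor (τ : LineBundle.TensorProduct L M N) :
    N.atiyahClass = L.atiyahClass + M.atiyahClass := by
  obtain ⟨𝒰, g, h, ⟨S⟩, ⟨T⟩⟩ := L.exists_framing_pair M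
  rw [← S.atiyahClass_eq_lineBundle, ← T.atiyahClass_eq_lineBundle, ← Framing.atiyahClass_tmul τ,
    Framing.atiyahClass_eq_lineBundle]

/-- A line bundle has a holomorphic connection if and only if its class in `H¹(X, Ω¹)` vanishes. -/
theorem LineBundle.nonempty_connection_iff (L : LineBundle E X) :
    Nonempty (Connection L) ↔ L.atiyahClass = 0 := by
  obtain ⟨𝒰, g, ⟨S⟩⟩ := L.exists_framing
  rw [← S.atiyahClass_eq_lineBundle, Framing.atiyahClass, cechClass_eq_zero_iff]
  constructor
  · rintro ⟨D⟩
    -- No refinement is needed: the connection forms in the given frames bound dlog g.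
    exact ⟨𝒰, le_rfl, _, (ConnFraming.ofFraming ⟨L, D⟩ S).dlog_eq_delta.symm⟩
  · rintro ⟨𝒱, hU, b, hb⟩
    exact ⟨(S.res hU).connection (hb.trans (resC1_dlogCochain hU g)).symm⟩

/-- Frames as in `LocalFrames`. -/
def LocalFrames.framing (T : LocalFrames L) :
    Framing L T.cover fun i j => Additive.ofMul (T.trans i j) where
  frame := T.frame
  ne_zero := T.frame_ne_zero
  frame_eq i j x hi hj :=
    congrFun (congrArg (fun s : L.sec (T.cover.toFun i ⊓ T.cover.toFun j) => s.1)
      (T.frame_eq i j)) ⟨x, hi, hj⟩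

end AtiyahClass

/-! ### The two Picard groups. -/

section Groups

variable (E X)

/-- The group structure on the set of isomorphism classes of line bundles. -/
theorem exists_addCommGroup_picAn :
    (∀ L M : LineBundle E X, ∃ N, Nonempty (LineBundle.TensorProduct L M N)) ∧
    ∃ _ : AddCommGroup (PicAn E X), (LineBundle.trivial E X).cls = 0 ∧
      ∀ L M N : LineBundle E X, Nonempty (LineBundle.TensorProduct L M N) →
        N.cls = L.cls + M.cls := by
  refine exists_addCommGroup_quotient (s := LineBundle.setoid (E := E) (X := X))
    (fun L M N => Nonempty (LineBundle.TensorProduct L M N))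
    -- All families of units are admitted, which makes this a group at once; a framing forces the
    -- cocycle condition on its own.
    (K := fun 𝒰 : PointCover X => Trans E 𝒰) (fun 𝒰 L g => Nonempty (Framing L 𝒰 g))
    (LineBundle.trivial E X) LineBundle.exists_framing ?_ ?_ ?_ ?_ ?_ ?_ ?_ ?_
  · rintro 𝒰 𝒱 hU L g ⟨S⟩
    exact ⟨_, ⟨S.res hU⟩⟩
  · rintro 𝒰 L M g ⟨S⟩ ⟨T⟩
    exact ⟨S.iso T⟩
  · rintro 𝒰 L M g ⟨φ⟩ ⟨S⟩
    exact ⟨S.map φ⟩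
  · rintro 𝒰 L M N g h ⟨τ⟩ ⟨S⟩ ⟨T⟩
    exact ⟨S.tmul τ T⟩
  · rintro 𝒰 L M N g h ⟨S⟩ ⟨T⟩ ⟨R⟩
    exact ⟨S.tensor T R⟩
  · exact fun 𝒰 => ⟨Framing.one 𝒰⟩
  · rintro 𝒰 L M g h ⟨S⟩ ⟨T⟩
    exact ⟨_, ⟨(S.isCocycle.add T.isCocycle).framing⟩⟩
  · rintro 𝒰 L g ⟨S⟩
    exact ⟨_, ⟨S.isCocycle.neg.framing⟩⟩

set_option synthInstance.maxHeartbeats 200000 in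
/-- The group structure on the set of isomorphism classes of line bundles with connection. -/
theorem exists_addCommGroup_picC :
    (∀ P Q : ConnLineBundle E X, ∃ R, Nonempty (ConnLineBundle.TensorProduct P Q R)) ∧
    ∃ _ : AddCommGroup (PicC E X), formToPicC (0 : holForm E (⊤ : Opens X)) = 0 ∧
      ∀ P Q R : ConnLineBundle E X, Nonempty (ConnLineBundle.TensorProduct P Q R) →
        R.cls = P.cls + Q.cls := by
  refine exists_addCommGroup_quotient (s := ConnLineBundle.setoid (E := E) (X := X))
    (fun P Q R => Nonempty (ConnLineBundle.TensorProduct P Q R))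
    (K := fun 𝒰 : PointCover X => Trans E 𝒰 × FormC0 E 𝒰)
    (fun 𝒰 P k => Nonempty (ConnFraming P 𝒰 k.1 k.2))
    ⟨LineBundle.trivial E X, trivialConn 0⟩ ?_ ?_ ?_ ?_ ?_ ?_ ?_ ?_ ?_
  · intro P
    obtain ⟨𝒰, g, ⟨S⟩⟩ := P.bundle.exists_framing
    exact ⟨𝒰, ⟨g, _⟩, ⟨ConnFraming.ofFraming P S⟩⟩
  · rintro 𝒰 𝒱 hU P k ⟨S⟩
    exact ⟨⟨_, _⟩, ⟨S.res hU⟩⟩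
  · rintro 𝒰 P Q k ⟨S⟩ ⟨T⟩
    exact ⟨S.iso T⟩
  · rintro 𝒰 P Q k ⟨φ⟩ ⟨S⟩
    exact ⟨S.map φ⟩
  · rintro 𝒰 P Q R k l ⟨τ⟩ ⟨S⟩ ⟨T⟩
    exact ⟨S.tmul τ T⟩
  · rintro 𝒰 P Q R k l ⟨S⟩ ⟨T⟩ ⟨Z⟩
    exact ⟨S.tensor T Z⟩
  · exact fun 𝒰 => ⟨ConnFraming.one 𝒰 0⟩
  · rintro 𝒰 P Q k l ⟨S⟩ ⟨T⟩
    -- The relation dlog g = δη is additive in (g, η), so the bundle with the product cocycle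
    -- carries a connection with the summed forms.
    have H : dlogCochain 𝒰 (k.1 + l.1) = formDelta E 𝒰 (k.2 + l.2) := by
      rw [map_add, map_add, S.dlog_eq_delta, T.dlog_eq_delta]
    exact ⟨_, ⟨(S.isCocycle.add T.isCocycle).framing.connFraming H⟩⟩
  · rintro 𝒰 P k ⟨S⟩
    have H : dlogCochain 𝒰 (-k.1) = formDelta E 𝒰 (-k.2) := by
      rw [map_neg, map_neg, S.dlog_eq_delta]
    exact ⟨_, ⟨S.isCocycle.neg.framing.connFraming H⟩⟩

end Groups

/-! ### Exactness at H⁰(X, Ω¹) and at Pic_c. -/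

section Exactness

/-- The covering with all members equal to `X`. -/
def PointCover.whole (X : Type*) [TopologicalSpace X] : PointCover X := ⟨fun _ => ⊤, fun _ => trivial⟩

/-- `(𝒪, d + η) ⊗ (𝒪, d + ζ) = (𝒪, d + η + ζ)`. -/
theorem nonempty_tensor_trivialConn (η ζ : holForm E (⊤ : Opens X)) :
    Nonempty (ConnLineBundle.TensorProduct ⟨LineBundle.trivial E X, trivialConn η⟩
      ⟨LineBundle.trivial E X, trivialConn ζ⟩ ⟨LineBundle.trivial E X, trivialConn (η + ζ)⟩) := by
  have h := ConnFraming.one (PointCover.whole X) (η + ζ)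
  -- The trivial transition functions 0 are rewritten as 0 + 0, the form expected for a tensor
  -- product.
  rw [← add_zero (0 : Trans E (PointCover.whole X))] at h
  exact ⟨(ConnFraming.one (PointCover.whole X) η).tensor (ConnFraming.one (PointCover.whole X) ζ) h⟩

/-- Multiplication by an invertible function `g` is an isomorphism from `(𝒪, d + dg / g)` to
`(𝒪, d)`. -/
theorem formToPicC_dlog (g : Additive (holFun E (⊤ : Opens X))ˣ) :
    formToPicC (dlog _ g) = formToPicC 0 := by
  have key (x : (⊤ : Opens X)) (v : TangentSpace 𝓘(ℂ, E) (x : X)) :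
      ((dForm g.toMul.val).1 x v + g.toMul.val.1 x * 0 : ℂ) =
        ((dlog _ g).1 x v : ℂ) * g.toMul.val.1 x := by
    rw [dlog_apply, mul_zero, add_zero, mul_right_comm,
      inv_mul_cancel₀ (unit_ne_zero g.toMul x), one_mul]
  -- In (𝒪, d) the frame g has connection form dg / g, as does the frame 1 in (𝒪, d + dg / g); equal
  -- data give the isomorphism.
  let S : ConnFraming ⟨LineBundle.trivial E X, trivialConn 0⟩ (PointCover.whole X) 0
      fun _ => HolSec.res le_top (dlog _ g) :=
    { frame := fun _ => funToTrivial g.toMul.val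
      ne_zero := fun _ x => unit_ne_zero g.toMul x
      frame_eq := fun _ _ _ _ _ => (one_smul ℂ _).symm
      isConnForm := fun _ x v => key x v }
  exact Quotient.sound ⟨(ConnFraming.one (PointCover.whole X) (dlog _ g)).iso S⟩

/-- An isomorphism from (𝒪, d + η) to (𝒪, d) is multiplication by the image u of 1, and its
compatibility with the connections at 1 says du = u η. -/
theorem exists_dlog_eq_of_formToPicC_eq {η : holForm E (⊤ : Opens X)}
    (h : formToPicC η = formToPicC 0) : ∃ g, dlog (⊤ : Opens X) g = η := by
  obtain ⟨φ⟩ := Quotient.exact h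
  set e : (LineBundle.trivial E X).sec ⊤ := funToTrivial 1
  have he : ∀ x, e.1 x ≠ 0 := fun _ => one_ne_zero (α := ℂ)
  set u : holFun E (⊤ : Opens X) := trivialToFun (φ.toIso.map e)
  have hu : ∀ x, u.1 x ≠ 0 := fun x => φ.toIso.map_ne_zero he x
  refine ⟨Additive.ofMul (unitOfNeZero u hu), ?_⟩
  ext x v
  refine (dlog_apply (Additive.ofMul (unitOfNeZero u hu)) x v).trans ?_
  have h1 := φ.comm ⊤ e x v
  change ((dForm u).1 x v + u.1 x * 0 : ℂ) =
    φ.toIso.equiv x (((dForm (1 : holFun E (⊤ : Opens X))).1 x v + 1 * η.1 x v : ℂ)) at h1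
  rw [dForm_one_apply, zero_add, mul_zero, add_zero, one_mul] at h1
  have h3 : φ.toIso.equiv x (η.1 x v : ℂ) = (η.1 x v : ℂ) * u.1 x := by
    have := (φ.toIso.equiv x).map_smul (η.1 x v : ℂ) (e.1 x)
    refine Eq.trans ?_ this
    exact congrArg (φ.toIso.equiv x) (mul_one (η.1 x v : ℂ)).symm
  change (u.1 x)⁻¹ * _ = _
  rw [inv_mul_eq_iff_eq_mul₀ (hu x), mul_comm]
  exact h1.trans h3

/-- A connection on a trivial line bundle is of the form `d + η`. -/
theorem exists_formToPicC_eq (P : ConnLineBundle E X)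
    (h : P.bundle.cls = (LineBundle.trivial E X).cls) : ∃ η, formToPicC η = P.cls := by
  obtain ⟨φ⟩ := Quotient.exact h.symm
  set e : P.bundle.sec ⊤ := φ.map (funToTrivial 1)
  have he : ∀ x, e.1 x ≠ 0 := φ.map_ne_zero fun _ => one_ne_zero (α := ℂ)
  refine ⟨LineBundle.formRatio e he (P.conn.nabla ⊤ e), ?_⟩
  let S : ConnFraming P (PointCover.whole X) 0
      fun _ => HolSec.res le_top (LineBundle.formRatio e he (P.conn.nabla ⊤ e)) :=
    { toFraming := (Framing.one (PointCover.whole X)).map φ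
      isConnForm := fun i => isConnForm_formRatio P.conn e he }
  exact Quotient.sound ⟨(ConnFraming.one (PointCover.whole X) _).iso S⟩

end Exactness

end HolLine

end

/-! ### The exact sequence. -/

theorem mainTheorem5
    {E : Type*} [NormedAddCommGroup E] [NormedSpace ℂ E] [FiniteDimensional ℂ E]
    {X : Type*} [TopologicalSpace X] [T2Space X] [ParacompactSpace X]
    [ChartedSpace E X] [IsManifold 𝓘(ℂ, E) ω X] :
    -- tensor products exist
    (∀ L M : HolLine.LineBundle E X, ∃ N, Nonempty (HolLine.LineBundle.TensorProduct L M N)) ∧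
    (∀ P Q : HolLine.ConnLineBundle E X, ∃ R,
      Nonempty (HolLine.ConnLineBundle.TensorProduct P Q R)) ∧
    -- they make the sets of isomorphism classes into abelian groups
    ∃ (_ : AddCommGroup (HolLine.PicAn E X)) (_ : AddCommGroup (HolLine.PicC E X)),
      (∀ L M N : HolLine.LineBundle E X,
        HolLine.LineBundle.TensorProduct L M N → N.cls = L.cls + M.cls) ∧
      (∀ P Q R : HolLine.ConnLineBundle E X,
        HolLine.ConnLineBundle.TensorProduct P Q R → R.cls = P.cls + Q.cls) ∧
      -- the homomorphisms of the sequence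
      ∃ (a : HolLine.holForm E (⊤ : TopologicalSpace.Opens X) →+ HolLine.PicC E X)
        (b : HolLine.PicC E X →+ HolLine.PicAn E X)
        (c : HolLine.PicAn E X →+ HolLine.H1Form E X),
        (∀ η, a η = HolLine.formToPicC η) ∧
        (∀ p, b p = HolLine.forgetConn p) ∧
        (∀ L : HolLine.LineBundle E X, Nonempty (HolLine.LocalFrames L)) ∧
        (∀ (L : HolLine.LineBundle E X) (T : HolLine.LocalFrames L),
          ∃ h : T.dlogTrans ∈ HolLine.Z1Form T.cover, c L.cls = HolLine.cechClass ⟨T.dlogTrans, h⟩) ∧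
        -- exactness
        Function.Exact (HolLine.dlog (E := E) (⊤ : TopologicalSpace.Opens X)) a ∧
        Function.Exact a b ∧
        Function.Exact b c ∧
        -- the criterion for the existence of a connection
        ∀ L : HolLine.LineBundle E X, Nonempty (HolLine.Connection L) ↔ c L.cls = 0 := by
  obtain ⟨exL, grpL, zeroL, addL⟩ := HolLine.exists_addCommGroup_picAn E X
  obtain ⟨exP, grpP, zeroP, addP⟩ := HolLine.exists_addCommGroup_picC E X
  let a : HolLine.holForm E (⊤ : TopologicalSpace.Opens X) →+ HolLine.PicC E X :=
    { toFun := HolLine.formToPicC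
      map_zero' := zeroP
      map_add' := fun η ζ => addP _ _ _ (HolLine.nonempty_tensor_trivialConn η ζ) }
  let b : HolLine.PicC E X →+ HolLine.PicAn E X :=
    { toFun := HolLine.forgetConn
      map_zero' := by
        rw [← zeroP, ← zeroL]
        rfl
      map_add' := fun p q => by
        induction p using Quotient.inductionOn with | _ P
        induction q using Quotient.inductionOn with | _ Q
        obtain ⟨R, ⟨τ⟩⟩ := exP P Q
        exact (congrArg HolLine.forgetConn (addP P Q R ⟨τ⟩).symm).trans
          (addL _ _ _ ⟨τ.toTensorProduct⟩) }
  let c : HolLine.PicAn E X →+ HolLine.H1Form E X :=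
    AddMonoidHom.mk' HolLine.atiyahMap fun p q => by
        induction p using Quotient.inductionOn with | _ L
        induction q using Quotient.inductionOn with | _ M
        obtain ⟨N, ⟨τ⟩⟩ := exL L M
        exact (congrArg HolLine.atiyahMap (addL L M N ⟨τ⟩).symm).trans
          (HolLine.LineBundle.atiyahClass_tensor τ)
  have crit (L : HolLine.LineBundle E X) : Nonempty (HolLine.Connection L) ↔ c L.cls = 0 :=
    L.nonempty_connection_iff
  refine ⟨exL, exP, grpL, grpP, fun L M N τ => addL L M N ⟨τ⟩, fun P Q R τ => addP P Q R ⟨τ⟩,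
    a, b, c, fun _ => rfl, fun _ => rfl, HolLine.LineBundle.nonempty_localFrames,
    -- The map c uses an arbitrarily chosen framing; independence of that choice allows T instead.
    fun L T => ⟨T.framing.isCocycle.dlogCochain_mem, T.framing.atiyahClass_eq_lineBundle.symm⟩,
    fun η => ?_, fun p => ?_, fun q => ?_, crit⟩
  · change HolLine.formToPicC η = 0 ↔ _
    rw [← zeroP]
    refine ⟨HolLine.exists_dlog_eq_of_formToPicC_eq, ?_⟩
    rintro ⟨g, rfl⟩
    exact HolLine.formToPicC_dlog g
  · induction p using Quotient.inductionOn with | _ P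
    change P.bundle.cls = 0 ↔ _
    rw [← zeroL]
    refine ⟨HolLine.exists_formToPicC_eq P, ?_⟩
    rintro ⟨η, hη⟩
    exact (congrArg HolLine.forgetConn hη).symm
  · induction q using Quotient.inductionOn with | _ L
    refine (crit L).symm.trans ⟨fun ⟨D⟩ => ⟨HolLine.ConnLineBundle.cls ⟨L, D⟩, rfl⟩, ?_⟩
    rintro ⟨p, hp⟩
    induction p using Quotient.inductionOn with | _ P
    -- P.bundle is only isomorphic to L; its connection makes their common class in H¹ vanish, and
    -- the criterion then applies to L.
    exact (crit L).2 ((congrArg c hp).symm.trans ((crit P.bundle).1 ⟨P.conn⟩))
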